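/- Let $n\ge 1$ and let $K\subset\mathbb R^{n+1}$ be a compact convex set with the origin in its interior whose boundary $\mathcal M^n=\partial K$ is a closed $C^\infty$-smooth, strictly convex hypersurface with strictly positive Gauss curvature. Let $h(x)=\max_{p\in K}\langle p,x\rangle$ $(x\in\mathbb R^{n+1})$ be the support function of $K$, $Dh$ its Euclidean gradient, and, for a unit vector $x\in\mathbb S^n$, let $\mathcal K(x)$ be the Gauss curvature of $\mathcal M^n$ at the point with outer unit normal $x$, that is, $$\frac1{\mathcal K(x)}=\det\big(D^2h(x)|_{x^\perp}\big)=\frac{\det(\bar\nabla^2h+\bar g\,h)}{\det \bar g}\Big|_x ,$$ where $\bar g$ and $\bar\nabla$ are the round metric of $\mathbb S^n$ and its Levi-Civita connection. Let $\varphi:(0,\infty)\times(0,\infty)\to(0,\infty)$ be $C^1$-smooth with $\partial_1\varphi\ge0$ and $\partial_2\varphi\ge0$, such that at every point of $(0,\infty)\times(0,\infty)$ at least one of these two inequalities is strict (in particular, it suffices that $\partial_1\varphi>0$ everywhere or $\partial_2\varphi>0$ everywhere). Suppose that $\mathcal M^n$ is origin-centred, i.e. the centroid of $K$ is at the origin,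 and that $$\varphi\big(h(x),|Dh(x)|\big)\,\mathcal K(x)=h(x)^{n+2}\qquad\text{for all }x\in\mathbb S^n .$$ Then $\mathcal M^n$ is a sphere centred at the origin. -/

import Mathlib

open scoped ContDiff

/-- The set `M ⊆ ℝⁿ⁺¹` is a smooth (that is, `C^∞`) embedded hypersurface: near each of its points it
is the zero set of a smooth real function without critical points. -/
def IsSmoothHypersurface {n : ℕ} (M : Set (EuclideanSpace ℝ (Fin (n + 1)))) : Prop :=
  ∀ p ∈ M, ∃ (U : Set (EuclideanSpace ℝ (Fin (n + 1)))) (f : EuclideanSpace ℝ (Fin (n + 1)) → ℝ),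
    IsOpen U ∧ p ∈ U ∧ ContDiffOn ℝ ∞ f U ∧ (∀ q ∈ U, fderiv ℝ f q ≠ 0) ∧
      M ∩ U = {q | q ∈ U ∧ f q = 0}

/-- `u` is an outer unit normal vector of the convex set `K` at its point `p`. -/
def IsOuterUnitNormal {n : ℕ} (K : Set (EuclideanSpace ℝ (Fin (n + 1))))
    (p u : EuclideanSpace ℝ (Fin (n + 1))) : Prop :=
  p ∈ K ∧ ‖u‖ = 1 ∧ ∀ q ∈ K, inner ℝ q u ≤ inner ℝ p u

/-- The determinant of the linear map `A`, restricted to the hyperplane `u^⊥` and followed by the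
orthogonal projection to `u^⊥`. (For a bilinear form `⟨A v, w⟩` on `u^⊥`, this is the determinant of
its matrix in any orthonormal basis of `u^⊥`.) -/
noncomputable def tangentialDet {n : ℕ} (u : EuclideanSpace ℝ (Fin (n + 1)))
    (A : EuclideanSpace ℝ (Fin (n + 1)) →L[ℝ] EuclideanSpace ℝ (Fin (n + 1))) : ℝ :=
  LinearMap.det
    (((ℝ ∙ u)ᗮ.orthogonalProjectionOnto ∘L A ∘L (ℝ ∙ u)ᗮ.subtypeL :
      (ℝ ∙ u)ᗮ →L[ℝ] (ℝ ∙ u)ᗮ) : (ℝ ∙ u)ᗮ →ₗ[ℝ] (ℝ ∙ u)ᗮ)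

/-- The boundary of the convex set `K` has Gauss curvature `κ` at `p`: the Gauss map (outer unit
normal) of `∂K` extends near `p` to a smooth vector field `N`, and `κ` is the determinant of its
differential on the tangent space `N(p)^⊥` of `∂K` at `p`. -/
def HasGaussCurvatureAt {n : ℕ} (K : Set (EuclideanSpace ℝ (Fin (n + 1))))
    (p : EuclideanSpace ℝ (Fin (n + 1))) (κ : ℝ) : Prop :=
  ∃ (U : Set (EuclideanSpace ℝ (Fin (n + 1))))
    (N : EuclideanSpace ℝ (Fin (n + 1)) → EuclideanSpace ℝ (Fin (n + 1))),
    IsOpen U ∧ p ∈ U ∧ ContDiffOn ℝ ∞ N U ∧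
      (∀ q ∈ frontier K ∩ U, IsOuterUnitNormal K q (N q)) ∧
      κ = tangentialDet (N p) (fderiv ℝ N p)

/-- The boundary `∂K` is a closed, smooth, strictly convex hypersurface: it bounds the compact,
strictly convex set `K`, which has the origin in its interior, and its Gauss curvature is strictly
positive. -/
structure IsSmoothStrictlyConvexBody {n : ℕ} (K : Set (EuclideanSpace ℝ (Fin (n + 1)))) :
    Prop where
  isCompact : IsCompact K
  strictConvex : StrictConvex ℝ K
  zero_mem_interior : (0 : EuclideanSpace ℝ (Fin (n + 1))) ∈ interior K
  smooth : IsSmoothHypersurface (frontier K)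
  curvature_pos : ∀ p ∈ frontier K, ∃ κ : ℝ, 0 < κ ∧ HasGaussCurvatureAt K p κ

/-- The support function `h(x) = sup {⟨p, x⟩ : p ∈ K}`, on the whole of `ℝⁿ⁺¹`. -/
noncomputable def supportFunction {n : ℕ} (K : Set (EuclideanSpace ℝ (Fin (n + 1))))
    (x : EuclideanSpace ℝ (Fin (n + 1))) : ℝ :=
  sSup ((fun p => (inner ℝ p x : ℝ)) '' K)

/-- The Gauss curvature of `∂K` as a function of the outer unit normal `x`, given by
`1 / 𝒦(x) = det (∇̄²h + ḡ h) / det ḡ`, where `∇̄²h + ḡ h` is the restriction to the tangent space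
`x^⊥` of the unit sphere of the Euclidean Hessian `D²h` of the support function. -/
noncomputable def gaussCurvature {n : ℕ} (K : Set (EuclideanSpace ℝ (Fin (n + 1))))
    (x : EuclideanSpace ℝ (Fin (n + 1))) : ℝ :=
  (tangentialDet x (fderiv ℝ (gradient (supportFunction K)) x))⁻¹

/-- The centroid `(1 / vol K) ∫_K x dx` of `K`. -/
noncomputable def centroidOf {n : ℕ} (K : Set (EuclideanSpace ℝ (Fin (n + 1)))) :
    EuclideanSpace ℝ (Fin (n + 1)) :=
  (MeasureTheory.volume.real K)⁻¹ • ∫ x in K, x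

/-! Write `X = ∇h`, `H = h²/2` and `T = ∇H = h X`. Then `D²H = h D²h + X ⊗ X` is homogeneous of
degree 0, and at a unit vector `x` its determinant is `h^(n+2) det(D²h|x^⊥) = h^(n+2) / 𝒦`. The
curvature equation therefore says that `w := det D²H` equals `φ(h(y)/|y|, |X(y)|)` at every `y ≠ 0`.

The Legendre transform of `H` is `H* = gauge²/2`. It satisfies `H*(T y) = H(y)`, and `T` carries
`e^{-H} w dy` to the log-concave measure `e^{-H*} dx`, whose mean is 0 because the centroid of `K`
is. The Brascamp–Lieb inequality for the linear function `⟨·, e⟩`, written in the variable `y`,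
becomes `∫ e^{-H} w ⟨T, e⟩² ≤ ∫ e^{-H} w ⟨D²H e, e⟩` (`integral_inner_sq_le`). It is derived from
Prékopa–Leindler by a second-order expansion. Integrating `∂_e (e^{-H} w ⟨T, e⟩)` then gives `∫
e^{-H} ∂_e w ⟨T, e⟩ ≤ 0` (`integral_exp_mul_fderiv_weight_nonpos`), and summing over an orthonormal
basis gives `∫ e^{-H} dw(T) ≤ 0`.

On the other hand `dw(T) ≥ 0` pointwise. Along `T` the quantity `h/|y|` is nondecreasing by
Cauchy–Schwarz, `|X|` is nondecreasing because `D²h ≥ 0`, and `φ` is monotone in both arguments.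
Hence `dw(T) = 0` everywhere (`fderiv_weight_dualityMap_eq_zero`). Where `∂₁φ > 0`, this is equality
in Cauchy–Schwarz. Where `∂₂φ > 0`, it gives `D²h X = 0`, and nondegeneracy of `D²H` applies. In
both cases `X` is parallel to `y`, so `h/|y|` is constant and `∂K` is a sphere
(`frontier_eq_sphere`). -/

open MeasureTheory Set

/-! ### The Prékopa–Leindler inequality at the midpoint. -/

/-- One-dimensional Brunn--Minkowski inequality for compact sets, at the midpoint. -/
theorem volume_add_le_two_mul_of_isCompact {A B C : Set ℝ} (hA : IsCompact A) (hB : IsCompact B)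
    (hA' : A.Nonempty) (hB' : B.Nonempty) (h : ∀ a ∈ A, ∀ b ∈ B, (a + b) / 2 ∈ C) :
    volume A + volume B ≤ 2 * volume C := by
  obtain ⟨a, ha, hmax⟩ := hA.exists_isGreatest hA'
  obtain ⟨b, hb, hmin⟩ := hB.exists_isLeast hB'
  have hvol : ∀ (D : Set ℝ) (c : ℝ), volume D = 2 * volume ((fun x : ℝ => 2 * x - c) ⁻¹' D) := by
    intro D c
    have h1 : (fun x : ℝ => 2 * x - c) ⁻¹' D = (fun x : ℝ => 2 * x) ⁻¹' ((fun x => x + (-c)) ⁻¹' D) := by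
      ext x; simp [sub_eq_add_neg]
    rw [h1, Real.volume_preimage_mul_left two_ne_zero, measure_preimage_add_right, ← mul_assoc]
    rw [show (2 : ENNReal) = ENNReal.ofReal 2 by simp, ← ENNReal.ofReal_mul (by norm_num)]
    norm_num
  -- These are `(A + b)/2` and `(B + a)/2` with `a = max A`, `b = min B`. Both lie in `C`, on
  -- opposite sides of `(a + b)/2`, so they share at most that point.
  set A' := (fun x : ℝ => 2 * x - b) ⁻¹' A
  set B' := (fun x : ℝ => 2 * x - a) ⁻¹' B
  have hB'm : MeasurableSet B' := hB.measurableSet.preimage (by fun_prop)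
  have hdisj : A' ∩ B' ⊆ {(a + b) / 2} := by
    rintro x ⟨h1, h2⟩
    have h3 := hmax h1
    have h4 := hmin h2
    simp only [mem_singleton_iff]
    linarith
  have hsub : A' ∪ B' ⊆ C := by
    rintro x (hx | hx)
    · have := h _ hx b hb
      simpa using this
    · have := h a ha _ hx
      simpa using this
  rw [hvol A b, hvol B a, ← mul_add]
  gcongr
  have h0 : volume (A' ∩ B') = 0 := measure_mono_null hdisj (by simp)
  rw [← measure_union_add_inter A' hB'm, h0, add_zero]
  exact measure_mono hsub

theorem volume_add_le_two_mul {A B C : Set ℝ} (hA : MeasurableSet A) (hB : MeasurableSet B)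
    (hA' : A.Nonempty) (hB' : B.Nonempty) (h : ∀ a ∈ A, ∀ b ∈ B, (a + b) / 2 ∈ C) :
    volume A + volume B ≤ 2 * volume C := by
  have key : ∀ K ⊆ A, ∀ L ⊆ B, IsCompact K → IsCompact L →
      volume K + volume L ≤ 2 * volume C := by
    intro K hK L hL hKc hLc
    obtain ⟨a, ha⟩ := hA'
    obtain ⟨b, hb⟩ := hB'
    -- An approximating compact subset may be empty; adjoining a point of the ambient set repairs
    -- this.
    calc volume K + volume L ≤ volume (insert a K) + volume (insert b L) := by
          gcongr <;> exact subset_insert _ _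
      _ ≤ _ := volume_add_le_two_mul_of_isCompact (hKc.insert a) (hLc.insert b)
          (insert_nonempty _ _) (insert_nonempty _ _) (fun x hx y hy =>
            h x (insert_subset ha hK hx) y (insert_subset hb hL hy))
  rw [hA.measure_eq_iSup_isCompact, hB.measure_eq_iSup_isCompact]
  have : Nonempty {K // K ⊆ A ∧ IsCompact K} := ⟨⟨∅, by simp⟩⟩
  have : Nonempty {K // K ⊆ B ∧ IsCompact K} := ⟨⟨∅, by simp⟩⟩
  have e : ∀ D : Set ℝ, (⨆ K, ⨆ (_ : K ⊆ D), ⨆ (_ : IsCompact K), volume K)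
      = ⨆ K : {K // K ⊆ D ∧ IsCompact K}, volume K.1 := by
    intro D
    simp only [iSup_subtype, iSup_and]
  rw [e A, e B]
  exact ENNReal.iSup_add_iSup_le fun K L => key K.1 K.2.1 L.1 L.2.1 K.2.2 L.2.2

theorem ENNReal.mul_le_sq_of_add_le_two_mul {a b c : ENNReal} (h : a + b ≤ 2 * c) :
    a * b ≤ c ^ 2 := by
  rcases eq_or_ne c ⊤ with rfl | hc
  · simp
  have hab : a + b ≠ ⊤ := ne_top_of_le_ne_top (ENNReal.mul_ne_top (by simp) hc) h
  obtain ⟨ha, hb⟩ := ENNReal.add_ne_top.mp hab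
  lift a to NNReal using ha
  lift b to NNReal using hb
  lift c to NNReal using hc
  norm_cast at h ⊢
  rw [← NNReal.coe_le_coe] at h ⊢
  push_cast at h ⊢
  nlinarith [sq_nonneg ((a : ℝ) - b), a.2, b.2, c.2]

/-- Layer cake formula for functions with values in `[0, 1]`. -/
theorem lintegral_eq_lintegral_meas_lt_of_le_one {α : Type*} [MeasurableSpace α] {μ : Measure α}
    {f : α → ENNReal} (hf : Measurable f) (h1 : ∀ x, f x ≤ 1) :
    ∫⁻ x, f x ∂μ = ∫⁻ t in Ioi (0 : ℝ), μ {x | ENNReal.ofReal t < f x} := by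
  have hne : ∀ x, f x ≠ ⊤ := fun x => ne_top_of_le_ne_top (by simp) (h1 x)
  have := lintegral_eq_lintegral_meas_lt μ (f := fun x => (f x).toReal)
    (Filter.Eventually.of_forall fun x => ENNReal.toReal_nonneg) hf.ennreal_toReal.aemeasurable
  rw [← lintegral_congr fun x => ENNReal.ofReal_toReal (hne x), this]
  refine setLIntegral_congr_fun measurableSet_Ioi fun t ht => ?_
  congr 1
  ext x
  simp only [mem_ofPred_eq]
  rw [ENNReal.ofReal_lt_iff_lt_toReal (le_of_lt ht) (hne x)]

/-- With both suprema equal to 1, the superlevel sets of `u` and `v` at each level `t < 1` are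
nonempty, so one-dimensional Brunn–Minkowski applies level by level. Layer cake then gives the
arithmetic bound `∫u + ∫v ≤ 2∫w`, which implies the product form. Truncating `w` at 1 does not
change its superlevel sets for `t < 1`. -/
theorem prekopa_leindler_real_of_iSup_eq_one {u v w : ℝ → ENNReal} (hu : Measurable u)
    (hv : Measurable v) (hw : Measurable w) (hu1 : ⨆ x, u x = 1) (hv1 : ⨆ x, v x = 1)
    (h : ∀ x y, u x * v y ≤ w ((x + y) / 2) ^ 2) :
    (∫⁻ x, u x) * (∫⁻ x, v x) ≤ (∫⁻ x, w x) ^ 2 := by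
  have hu' : ∀ x, u x ≤ 1 := fun x => hu1 ▸ le_iSup u x
  have hv' : ∀ x, v x ≤ 1 := fun x => hv1 ▸ le_iSup v x
  refine ENNReal.mul_le_sq_of_add_le_two_mul ?_
  have hw' : ∫⁻ x, min (w x) 1 ≤ ∫⁻ x, w x := lintegral_mono fun x => min_le_left _ _
  refine le_trans ?_ (mul_le_mul_right hw' 2)
  have hwm : Measurable fun x => min (w x) 1 := hw.min measurable_const
  rw [lintegral_eq_lintegral_meas_lt_of_le_one hu hu',
    lintegral_eq_lintegral_meas_lt_of_le_one hv hv',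
    lintegral_eq_lintegral_meas_lt_of_le_one hwm (fun x => min_le_right _ _)]
  have hanti : ∀ f : ℝ → ENNReal, Measurable fun t : ℝ => volume {x | ENNReal.ofReal t < f x} := by
    intro f
    refine Antitone.measurable fun s t hst => measure_mono fun x hx => ?_
    exact lt_of_le_of_lt (ENNReal.ofReal_le_ofReal hst) hx
  rw [← lintegral_add_left (hanti u), ← lintegral_const_mul _ (hanti _)]
  refine lintegral_mono fun t => ?_
  simp only
  rcases lt_or_ge (ENNReal.ofReal t) 1 with ht | ht
  · refine volume_add_le_two_mul (measurableSet_lt measurable_const hu)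
      (measurableSet_lt measurable_const hv) ?_ ?_ ?_
    · rw [← hu1] at ht
      exact lt_iSup_iff.mp ht
    · rw [← hv1] at ht
      exact lt_iSup_iff.mp ht
    · intro a ha b hb
      simp only [mem_ofPred_eq] at ha hb ⊢
      refine lt_min ?_ ht
      by_contra hcon
      push Not at hcon
      have h2 : ENNReal.ofReal t * ENNReal.ofReal t < u a * v b :=
        ENNReal.mul_lt_mul ha hb
      have h3 := h2.trans_le (h a b)
      rw [sq] at h3
      exact absurd h3 (not_lt.mpr (mul_le_mul' hcon hcon))
  · have e : ∀ f : ℝ → ENNReal, (∀ x, f x ≤ 1) → {x | ENNReal.ofReal t < f x} = ∅ := by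
      intro f hf
      ext x
      simpa using (hf x).trans ht
    simp [e u hu', e v hv']

/-- Truncation at height `k` makes the suprema finite, and rescaling makes them 1; `w` absorbs the
square root of the product of the two scaling factors. -/
theorem prekopa_leindler_real {u v w : ℝ → ENNReal} (hu : Measurable u)
    (hv : Measurable v) (hw : Measurable w)
    (h : ∀ x y, u x * v y ≤ w ((x + y) / 2) ^ 2) :
    (∫⁻ x, u x) * (∫⁻ x, v x) ≤ (∫⁻ x, w x) ^ 2 := by
  have bdd : ∀ {u v : ℝ → ENNReal}, Measurable u → Measurable v → ⨆ x, u x ≠ ⊤ → ⨆ x, v x ≠ ⊤ →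
      (∀ x y, u x * v y ≤ w ((x + y) / 2) ^ 2) →
      (∫⁻ x, u x) * (∫⁻ x, v x) ≤ (∫⁻ x, w x) ^ 2 := by
    intro u v hu hv huf hvf h
    rcases eq_or_ne (⨆ x, u x) 0 with hu0 | hu0
    · have : u = 0 := by ext x; simpa using (ENNReal.iSup_eq_zero.mp hu0) x
      simp [this]
    rcases eq_or_ne (⨆ x, v x) 0 with hv0 | hv0
    · have : v = 0 := by ext x; simpa using (ENNReal.iSup_eq_zero.mp hv0) x
      simp [this]
    set α := ⨆ x, u x
    set β := ⨆ x, v x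
    obtain ⟨γ, hγ⟩ : ∃ γ : ENNReal, γ ^ 2 = α⁻¹ * β⁻¹ :=
      ⟨(α⁻¹ * β⁻¹) ^ ((1 : ℝ) / 2), by
        rw [← ENNReal.rpow_natCast, ← ENNReal.rpow_mul]; norm_num⟩
    have key := prekopa_leindler_real_of_iSup_eq_one (u := fun x => α⁻¹ * u x)
      (v := fun x => β⁻¹ * v x) (w := fun x => γ * w x) (hu.const_mul _) (hv.const_mul _)
      (hw.const_mul _) (by rw [← ENNReal.mul_iSup]; exact ENNReal.inv_mul_cancel hu0 huf)
      (by rw [← ENNReal.mul_iSup]; exact ENNReal.inv_mul_cancel hv0 hvf) (by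
        intro x y
        calc α⁻¹ * u x * (β⁻¹ * v y) = α⁻¹ * β⁻¹ * (u x * v y) := by ring
          _ ≤ α⁻¹ * β⁻¹ * w ((x + y) / 2) ^ 2 := by gcongr; exact h x y
          _ = _ := by rw [← hγ]; ring)
    rw [lintegral_const_mul _ hu, lintegral_const_mul _ hv, lintegral_const_mul _ hw, mul_pow, hγ]
      at key
    have hc0 : α⁻¹ * β⁻¹ ≠ 0 := mul_ne_zero (by simpa using huf) (by simpa using hvf)
    have hct : α⁻¹ * β⁻¹ ≠ ⊤ := ENNReal.mul_ne_top (by simpa using hu0) (by simpa using hv0)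
    refine (ENNReal.mul_le_mul_iff_right hc0 hct).mp ?_
    calc _ = α⁻¹ * (∫⁻ x, u x) * (β⁻¹ * ∫⁻ x, v x) := by ring
      _ ≤ _ := key
  have hmono : ∀ u : ℝ → ENNReal, Measurable u →
      ∫⁻ x, u x = ⨆ k : ℕ, ∫⁻ x, min (u x) k := by
    intro u hu
    rw [← lintegral_iSup (fun k => hu.min measurable_const)
      (fun i j hij x => min_le_min le_rfl (by exact_mod_cast hij))]
    refine lintegral_congr fun x => ?_
    refine le_antisymm ?_ (iSup_le fun k => min_le_left _ _)
    refine le_of_forall_lt fun c hc => ?_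
    obtain ⟨k, hk⟩ := ENNReal.exists_nat_gt hc.ne_top
    exact lt_iSup_iff.mpr ⟨k, lt_min hc hk⟩
  rw [hmono u hu, hmono v hv, ENNReal.iSup_mul]
  refine iSup_le fun k => ?_
  rw [ENNReal.mul_iSup]
  refine iSup_le fun l => ?_
  refine bdd (hu.min measurable_const) (hv.min measurable_const) ?_ ?_ fun x y => ?_
  · exact ne_top_of_le_ne_top (ENNReal.natCast_ne_top k) (iSup_le fun x => min_le_right _ _)
  · exact ne_top_of_le_ne_top (ENNReal.natCast_ne_top l) (iSup_le fun x => min_le_right _ _)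
  · exact (mul_le_mul' (min_le_left _ _) (min_le_left _ _)).trans (h x y)

/-- The Prékopa--Leindler inequality at the midpoint, on `ℝⁿ`. -/
theorem prekopa_leindler_pi (n : ℕ) {u v w : (Fin n → ℝ) → ENNReal} (hu : Measurable u)
    (hv : Measurable v) (hw : Measurable w)
    (h : ∀ x y, u x * v y ≤ w ((2 : ℝ)⁻¹ • (x + y)) ^ 2) :
    (∫⁻ x, u x) * (∫⁻ x, v x) ≤ (∫⁻ x, w x) ^ 2 := by
  induction n with
  | zero =>
    have e : ∀ f : (Fin 0 → ℝ) → ENNReal, ∫⁻ x, f x = f 0 := by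
      intro f
      rw [lintegral_unique]
      have h0 : ∀ a, f a = f 0 := fun a => congrArg f (Subsingleton.elim _ _)
      rw [h0, volume_pi, Measure.pi_univ]
      simp
    rw [e, e, e]
    simpa using h 0 0
  | succ n ih =>
    have e : ∀ f : (Fin (n + 1) → ℝ) → ENNReal, Measurable f →
        ∫⁻ x, f x = ∫⁻ a : ℝ, ∫⁻ z : Fin n → ℝ, f (Fin.cons a z) := by
      intro f hf
      have mp := (volume_preserving_piFinSuccAbove (fun _ : Fin (n + 1) => ℝ) 0).symm
      rw [← mp.lintegral_comp hf, Measure.volume_eq_prod, lintegral_prod]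
      · simp [MeasurableEquiv.piFinSuccAbove_symm_apply, Fin.consEquiv]
      · exact (hf.comp (MeasurableEquiv.measurable _)).aemeasurable
    have hcons : Measurable fun p : ℝ × (Fin n → ℝ) => (Fin.cons p.1 p.2 : Fin (n + 1) → ℝ) := by
      simpa [MeasurableEquiv.piFinSuccAbove_symm_apply, Fin.insertNthEquiv] using
        (MeasurableEquiv.piFinSuccAbove (fun _ : Fin (n + 1) => ℝ) 0).symm.measurable
    rw [e u hu, e v hv, e w hw]
    -- The inductive hypothesis on slices with fixed first coordinate is exactly the one-dimensional
    -- hypothesis for the slice integrals.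
    refine prekopa_leindler_real (hu.comp hcons).lintegral_prod_right'
      (hv.comp hcons).lintegral_prod_right' (hw.comp hcons).lintegral_prod_right' fun a b => ?_
    refine ih (hu.comp (hcons.comp measurable_prodMk_left))
      (hv.comp (hcons.comp measurable_prodMk_left))
      (hw.comp (hcons.comp measurable_prodMk_left)) fun x y => ?_
    convert h (Fin.cons a x) (Fin.cons b y) using 3
    ext i
    refine Fin.cases ?_ (fun j => ?_) i
    · simp; ring
    · simp [mul_add]

theorem prekopa_leindler (n : ℕ) {u v w : EuclideanSpace ℝ (Fin n) → ENNReal} (hu : Measurable u)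
    (hv : Measurable v) (hw : Measurable w)
    (h : ∀ x y, u x * v y ≤ w ((2 : ℝ)⁻¹ • (x + y)) ^ 2) :
    (∫⁻ x, u x) * (∫⁻ x, v x) ≤ (∫⁻ x, w x) ^ 2 := by
  have mp := PiLp.volume_preserving_toLp (Fin n)
  have hm : Measurable (WithLp.toLp 2 : (Fin n → ℝ) → EuclideanSpace ℝ (Fin n)) := mp.measurable
  rw [← mp.lintegral_comp hu, ← mp.lintegral_comp hv, ← mp.lintegral_comp hw]
  exact prekopa_leindler_pi n (hu.comp hm) (hv.comp hm) (hw.comp hm) fun x y => h _ _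

/-! ### The support function of a strictly convex body; its gradient is the contact point. -/

section SupportFunction

open Filter Topology

variable {n : ℕ} {K : Set (EuclideanSpace ℝ (Fin (n + 1)))}

theorem inner_le_supportFunction (hK : IsCompact K) {p : EuclideanSpace ℝ (Fin (n + 1))}
    (hp : p ∈ K) (x : EuclideanSpace ℝ (Fin (n + 1))) :
    inner ℝ p x ≤ supportFunction K x :=
  le_csSup (hK.image (by fun_prop)).bddAbove (mem_image_of_mem _ hp)

theorem exists_inner_eq_supportFunction (hK : IsCompact K) (hne : K.Nonempty)
    (x : EuclideanSpace ℝ (Fin (n + 1))) : ∃ p ∈ K, inner ℝ p x = supportFunction K x := by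
  have := (hK.image (f := fun p => (inner ℝ p x : ℝ)) (by fun_prop)).sSup_mem (hne.image _)
  exact this

theorem inner_lt_supportFunction (hK : IsCompact K) {p : EuclideanSpace ℝ (Fin (n + 1))}
    (hp : p ∈ interior K) {x : EuclideanSpace ℝ (Fin (n + 1))} (hx : x ≠ 0) :
    inner ℝ p x < supportFunction K x := by
  have hcont : Tendsto (fun t : ℝ => p + t • x) (𝓝[>] 0) (𝓝 p) := by
    have : ContinuousAt (fun t : ℝ => p + t • x) 0 := by fun_prop
    have h2 := this.tendsto
    simp only [zero_smul, add_zero] at h2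
    exact h2.mono_left nhdsWithin_le_nhds
  have h1 : ∀ᶠ t : ℝ in 𝓝[>] 0, p + t • x ∈ K := hcont (mem_interior_iff_mem_nhds.mp hp)
  obtain ⟨t, ht, ht0⟩ := (h1.and self_mem_nhdsWithin).exists
  have h3 := inner_le_supportFunction hK ht x
  rw [inner_add_left, inner_smul_left] at h3
  have h4 : 0 < t * inner ℝ x x := mul_pos ht0 (real_inner_self_pos.mpr hx)
  simp only [conj_trivial] at h3
  linarith

theorem supportFunction_smul (hK : IsCompact K) (hne : K.Nonempty) {c : ℝ} (hc : 0 ≤ c)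
    (x : EuclideanSpace ℝ (Fin (n + 1))) :
    supportFunction K (c • x) = c * supportFunction K x := by
  obtain ⟨p, hp, hpx⟩ := exists_inner_eq_supportFunction hK hne x
  obtain ⟨q, hq, hqx⟩ := exists_inner_eq_supportFunction hK hne (c • x)
  have h1 := inner_le_supportFunction hK hp (c • x)
  have h2 := inner_le_supportFunction hK hq x
  rw [real_inner_smul_right] at hqx h1
  rw [hpx] at h1
  exact le_antisymm (hqx ▸ mul_le_mul_of_nonneg_left h2 hc) h1

theorem supportFunction_zero (hK : IsCompact K) (hne : K.Nonempty) :
    supportFunction K 0 = 0 := by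
  obtain ⟨p, hp, hpx⟩ := exists_inner_eq_supportFunction hK hne 0
  rw [← hpx, inner_zero_right]

theorem supportFunction_pos (hK : IsCompact K) (h0 : 0 ∈ interior K)
    {x : EuclideanSpace ℝ (Fin (n + 1))} (hx : x ≠ 0) : 0 < supportFunction K x := by
  simpa using inner_lt_supportFunction hK h0 hx

theorem mem_frontier_of_inner_eq_supportFunction (hK : IsCompact K)
    {p x : EuclideanSpace ℝ (Fin (n + 1))} (hp : p ∈ K) (hx : x ≠ 0)
    (h : inner ℝ p x = supportFunction K x) : p ∈ frontier K :=
  ⟨subset_closure hp, fun hi => (inner_lt_supportFunction hK hi hx).ne h⟩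

theorem eq_of_inner_eq_supportFunction (hK : IsCompact K) (hs : StrictConvex ℝ K)
    {p q x : EuclideanSpace ℝ (Fin (n + 1))} (hp : p ∈ K) (hq : q ∈ K) (hx : x ≠ 0)
    (hpx : inner ℝ p x = supportFunction K x) (hqx : inner ℝ q x = supportFunction K x) :
    p = q := by
  by_contra hne
  have hm := hs hp hq hne (a := 1 / 2) (b := 1 / 2) (by norm_num) (by norm_num) (by norm_num)
  have := inner_lt_supportFunction hK hm hx
  rw [inner_add_left, real_inner_smul_left, real_inner_smul_left, hpx, hqx] at this
  linarith

theorem continuous_supportFunction (hK : IsCompact K) (hne : K.Nonempty) :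
    Continuous (supportFunction K) := by
  obtain ⟨R, hR⟩ := hK.isBounded.exists_norm_le
  have hR0 : 0 ≤ R := (norm_nonneg _).trans (hR _ hne.some_mem)
  have key : ∀ x y, supportFunction K x - supportFunction K y ≤ R * ‖x - y‖ := by
    intro x y
    obtain ⟨p, hp, hpx⟩ := exists_inner_eq_supportFunction hK hne x
    have h1 := inner_le_supportFunction hK hp y
    calc supportFunction K x - supportFunction K y ≤ inner ℝ p x - inner ℝ p y := by linarith
      _ = inner ℝ p (x - y) := by rw [inner_sub_right]
      _ ≤ ‖p‖ * ‖x - y‖ := real_inner_le_norm _ _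
      _ ≤ R * ‖x - y‖ := by gcongr; exact hR p hp
  refine (LipschitzWith.of_dist_le_mul (K := R.toNNReal) fun x y => ?_).continuous
  rw [Real.dist_eq, dist_eq_norm, Real.coe_toNNReal _ hR0, abs_le]
  constructor
  · have := key y x
    rw [norm_sub_rev] at this
    linarith
  · exact key x y

/-- Any cluster point of `X z` as `z → y` lies in `K` and attains the maximum in direction `y`.
Strict convexity leaves only `X y`, and compactness turns this into convergence. -/
theorem continuousAt_of_inner_eq_supportFunction (hK : IsCompact K) (hs : StrictConvex ℝ K)
    (hne : K.Nonempty) {X : EuclideanSpace ℝ (Fin (n + 1)) → EuclideanSpace ℝ (Fin (n + 1))}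
    (hXK : ∀ y, X y ∈ K) (hX : ∀ y, inner ℝ (X y) y = supportFunction K y)
    {y : EuclideanSpace ℝ (Fin (n + 1))} (hy : y ≠ 0) : ContinuousAt X y := by
  obtain ⟨R, hR⟩ := hK.isBounded.exists_norm_le
  have hlim : Tendsto (fun z => inner ℝ (X z) y) (𝓝 y) (𝓝 (supportFunction K y)) := by
    have h1 : ∀ z, inner ℝ (X z) y = supportFunction K z - inner ℝ (X z) (z - y) := by
      intro z
      rw [inner_sub_right, hX]
      ring
    have h2 : Tendsto (fun z => inner ℝ (X z) (z - y)) (𝓝 y) (𝓝 0) := by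
      refine squeeze_zero_norm (a := fun z => R * ‖z - y‖) (fun z => ?_) ?_
      · exact (norm_inner_le_norm _ _).trans (by gcongr; exact hR _ (hXK z))
      · have : ContinuousAt (fun z => R * ‖z - y‖) y := by fun_prop
        simpa using this.tendsto
    simp_rw [h1]
    simpa using ((continuous_supportFunction hK hne).tendsto y).sub h2
  refine hK.tendsto_nhds_of_unique_mapClusterPt (Eventually.of_forall hXK) fun p hp hcl => ?_
  refine eq_of_inner_eq_supportFunction hK hs hp (hXK y) hy ?_ (hX y)
  set q : EuclideanSpace ℝ (Fin (n + 1)) → ℝ := fun p => inner ℝ p y with hq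
  have hqc : ContinuousAt q p := by
    have : Continuous q := by fun_prop
    exact this.continuousAt
  have h3 : MapClusterPt (q p) (𝓝 y) (q ∘ X) := hcl.continuousAt_comp hqc
  have h4 : ClusterPt (q p) (𝓝 (supportFunction K y)) := ClusterPt.mono h3 hlim
  have : (𝓝 (q p) ⊓ 𝓝 (supportFunction K y)).NeBot := h4
  exact eq_of_nhds_neBot this

/-- The increment `h z - h y` lies between `⟨X y, z - y⟩` and `⟨X z, z - y⟩`, and `X` is continuous
at `y`. -/
theorem hasGradientAt_of_inner_eq_supportFunction (hK : IsCompact K) (hs : StrictConvex ℝ K)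
    (hne : K.Nonempty) {X : EuclideanSpace ℝ (Fin (n + 1)) → EuclideanSpace ℝ (Fin (n + 1))}
    (hXK : ∀ y, X y ∈ K) (hX : ∀ y, inner ℝ (X y) y = supportFunction K y)
    {y : EuclideanSpace ℝ (Fin (n + 1))} (hy : y ≠ 0) :
    HasGradientAt (supportFunction K) (X y) y := by
  have hc := continuousAt_of_inner_eq_supportFunction hK hs hne hXK hX hy
  rw [hasGradientAt_iff_isLittleO, Asymptotics.isLittleO_iff]
  intro c hc0
  have h1 : ∀ᶠ z in 𝓝 y, ‖X z - X y‖ ≤ c := by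
    have := hc.tendsto.eventually (Metric.closedBall_mem_nhds (X y) hc0)
    filter_upwards [this] with z hz
    simpa [dist_eq_norm] using hz
  filter_upwards [h1] with z hz
  have h2 := inner_le_supportFunction hK (hXK y) z
  have h3 := inner_le_supportFunction hK (hXK z) y
  have h4 := (real_inner_le_norm (X z - X y) (z - y)).trans
    (mul_le_mul_of_nonneg_right hz (norm_nonneg _))
  rw [inner_sub_left, inner_sub_right, inner_sub_right, hX, hX] at h4
  rw [inner_sub_right, hX, Real.norm_eq_abs, abs_le]
  constructor <;> nlinarith [norm_nonneg (z - y)]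

/-- A point-valued selection of the support set in every direction. -/
theorem exists_support_selection (hK : IsCompact K) (hne : K.Nonempty) :
    ∃ X : EuclideanSpace ℝ (Fin (n + 1)) → EuclideanSpace ℝ (Fin (n + 1)),
      (∀ y, X y ∈ K) ∧ ∀ y, inner ℝ (X y) y = supportFunction K y := by
  choose X hX hX' using exists_inner_eq_supportFunction hK hne
  exact ⟨X, hX, hX'⟩

theorem gradient_supportFunction_mem (hK : IsCompact K) (hs : StrictConvex ℝ K)
    (hne : K.Nonempty) {y : EuclideanSpace ℝ (Fin (n + 1))} (hy : y ≠ 0) :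
    gradient (supportFunction K) y ∈ K := by
  obtain ⟨X, hXK, hX⟩ := exists_support_selection hK hne
  rw [(hasGradientAt_of_inner_eq_supportFunction hK hs hne hXK hX hy).gradient]
  exact hXK y

theorem inner_gradient_supportFunction (hK : IsCompact K) (hs : StrictConvex ℝ K)
    (hne : K.Nonempty) {y : EuclideanSpace ℝ (Fin (n + 1))} (hy : y ≠ 0) :
    inner ℝ (gradient (supportFunction K) y) y = supportFunction K y := by
  obtain ⟨X, hXK, hX⟩ := exists_support_selection hK hne
  rw [(hasGradientAt_of_inner_eq_supportFunction hK hs hne hXK hX hy).gradient]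
  exact hX y

theorem hasGradientAt_supportFunction (hK : IsCompact K) (hs : StrictConvex ℝ K)
    (hne : K.Nonempty) {y : EuclideanSpace ℝ (Fin (n + 1))} (hy : y ≠ 0) :
    HasGradientAt (supportFunction K) (gradient (supportFunction K) y) y := by
  obtain ⟨X, hXK, hX⟩ := exists_support_selection hK hne
  have := hasGradientAt_of_inner_eq_supportFunction hK hs hne hXK hX hy
  rwa [this.gradient]

theorem gradient_supportFunction_eq (hK : IsCompact K) (hs : StrictConvex ℝ K)
    {p y : EuclideanSpace ℝ (Fin (n + 1))} (hy : y ≠ 0) (hp : p ∈ K)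
    (h : inner ℝ p y = supportFunction K y) : gradient (supportFunction K) y = p :=
  eq_of_inner_eq_supportFunction hK hs (gradient_supportFunction_mem hK hs ⟨p, hp⟩ hy) hp hy
    (inner_gradient_supportFunction hK hs ⟨p, hp⟩ hy) h

theorem gradient_supportFunction_smul (hK : IsCompact K) (hs : StrictConvex ℝ K)
    (hne : K.Nonempty) {y : EuclideanSpace ℝ (Fin (n + 1))} (hy : y ≠ 0) {c : ℝ} (hc : 0 < c) :
    gradient (supportFunction K) (c • y) = gradient (supportFunction K) y := by
  refine gradient_supportFunction_eq hK hs (smul_ne_zero hc.ne' hy)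
    (gradient_supportFunction_mem hK hs hne hy) ?_
  rw [real_inner_smul_right, inner_gradient_supportFunction hK hs hne hy,
    supportFunction_smul hK hne hc.le]

theorem continuousAt_gradient_supportFunction (hK : IsCompact K) (hs : StrictConvex ℝ K)
    (hne : K.Nonempty) {y : EuclideanSpace ℝ (Fin (n + 1))} (hy : y ≠ 0) :
    ContinuousAt (gradient (supportFunction K)) y := by
  obtain ⟨X, hXK, hX⟩ := exists_support_selection hK hne
  refine (continuousAt_of_inner_eq_supportFunction hK hs hne hXK hX hy).congr ?_
  filter_upwards [isOpen_ne.mem_nhds hy] with z hz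
  rw [(hasGradientAt_of_inner_eq_supportFunction hK hs hne hXK hX hz).gradient]

end SupportFunction

/-! ### Smoothness of the inverse Gauss map. -/

section Regularity

open Filter Topology

variable {n : ℕ} {K : Set (EuclideanSpace ℝ (Fin (n + 1)))}

theorem IsOuterUnitNormal.ne_zero {p u : EuclideanSpace ℝ (Fin (n + 1))}
    (h : IsOuterUnitNormal K p u) : u ≠ 0 := by
  rintro rfl
  simpa using h.2.1

theorem IsOuterUnitNormal.inner_eq (hK : IsCompact K) {p u : EuclideanSpace ℝ (Fin (n + 1))}
    (h : IsOuterUnitNormal K p u) : inner ℝ p u = supportFunction K u := by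
  refine le_antisymm (inner_le_supportFunction hK h.1 u) ?_
  obtain ⟨q, hq, hqu⟩ := exists_inner_eq_supportFunction hK ⟨p, h.1⟩ u
  exact hqu ▸ h.2.2 q hq

theorem isOuterUnitNormal_gradient (hK : IsCompact K) (hs : StrictConvex ℝ K)
    (hne : K.Nonempty) {y : EuclideanSpace ℝ (Fin (n + 1))} (hy : y ≠ 0) :
    IsOuterUnitNormal K (gradient (supportFunction K) y) (‖y‖⁻¹ • y) := by
  refine ⟨gradient_supportFunction_mem hK hs hne hy, norm_smul_inv_norm hy, fun q hq => ?_⟩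
  rw [real_inner_smul_right, real_inner_smul_right, inner_gradient_supportFunction hK hs hne hy]
  gcongr
  exact inner_le_supportFunction hK hq y

/-- On the level set of `f` through `p` the function `⟨u, ·⟩` has a local maximum at `p`, so this is
the Lagrange multiplier rule. Neither multiplier can vanish, since `u ≠ 0` and `df ≠ 0`. -/
theorem exists_fderiv_eq_mul_inner {p u : EuclideanSpace ℝ (Fin (n + 1))}
    (hcl : IsClosed K) (hu : IsOuterUnitNormal K p u) (hp : p ∈ frontier K)
    {U : Set (EuclideanSpace ℝ (Fin (n + 1)))} {f : EuclideanSpace ℝ (Fin (n + 1)) → ℝ}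
    (hU : IsOpen U) (hpU : p ∈ U) (hf : ContDiffOn ℝ ∞ f U) (hf' : fderiv ℝ f p ≠ 0)
    (hfU : frontier K ∩ U = {q | q ∈ U ∧ f q = 0}) :
    ∃ c : ℝ, c ≠ 0 ∧ ∀ v, fderiv ℝ f p v = c * inner ℝ u v := by
  have hfp : f p = 0 := by
    have : p ∈ {q | q ∈ U ∧ f q = 0} := hfU ▸ ⟨hp, hpU⟩
    exact this.2
  have hstrict : HasStrictFDerivAt f (fderiv ℝ f p) p :=
    (hf.contDiffAt (hU.mem_nhds hpU)).hasStrictFDerivAt (by simp)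
  have hφ : HasStrictFDerivAt (fun q => inner ℝ u q) (innerSL ℝ u) p :=
    (innerSL ℝ u).hasStrictFDerivAt
  have hext : IsLocalExtrOn (fun q => (inner ℝ u q : ℝ)) {x | f x = f p} p := by
    right
    have : ∀ᶠ q in 𝓝[{x | f x = f p}] p, q ∈ U ∧ f q = f p :=
      (eventually_nhdsWithin_of_eventually_nhds (hU.mem_nhds hpU)).and self_mem_nhdsWithin
    filter_upwards [this] with q hq
    have hq' : q ∈ frontier K ∩ U := by
      rw [hfU]
      exact ⟨hq.1, hq.2.trans hfp⟩
    have := hu.2.2 q (hcl.frontier_subset hq'.1)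
    rwa [real_inner_comm q u, real_inner_comm p u]
  obtain ⟨a, b, hab, h⟩ := hext.exists_multipliers_of_hasStrictFDerivAt_1d hstrict hφ
  have hv : ∀ v, a * fderiv ℝ f p v + b * inner ℝ u v = 0 := by
    intro v
    have := DFunLike.congr_fun h v
    simpa using this
  have ha : a ≠ 0 := by
    rintro rfl
    have h2 := hv u
    rw [real_inner_self_eq_norm_sq, hu.2.1] at h2
    exact hab (by ext <;> simp_all)
  have hb : b ≠ 0 := by
    rintro rfl
    refine hf' (ContinuousLinearMap.ext fun v => ?_)
    simpa [ha] using hv v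
  refine ⟨-(b / a), by simp [ha, hb], fun v => ?_⟩
  have := hv v
  field_simp
  linarith

/-- Both normals are parallel to the gradient of a local defining function. The sign is settled by
`⟨p, u⟩ > 0`, which holds because the origin is interior. -/
theorem IsOuterUnitNormal.unique (hK : IsCompact K) (h0 : 0 ∈ interior K)
    (hsm : IsSmoothHypersurface (frontier K)) {p u u' : EuclideanSpace ℝ (Fin (n + 1))}
    (hp : p ∈ frontier K) (hu : IsOuterUnitNormal K p u) (hu' : IsOuterUnitNormal K p u') :
    u = u' := by
  obtain ⟨U, f, hU, hpU, hf, hf', hfU⟩ := hsm p hp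
  obtain ⟨c, hc, h⟩ := exists_fderiv_eq_mul_inner hK.isClosed hu hp hU hpU hf (hf' p hpU) hfU
  obtain ⟨c', hc', h'⟩ := exists_fderiv_eq_mul_inner hK.isClosed hu' hp hU hpU hf (hf' p hpU) hfU
  have e : c • u = c' • u' := by
    refine ext_inner_right ℝ fun v => ?_
    rw [real_inner_smul_left, real_inner_smul_left, ← h, ← h']
  have h1 : 0 < inner ℝ p u := hu.inner_eq hK ▸ supportFunction_pos hK h0 hu.ne_zero
  have h2 : 0 < inner ℝ p u' := hu'.inner_eq hK ▸ supportFunction_pos hK h0 hu'.ne_zero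
  have h3 : c * inner ℝ p u = c' * inner ℝ p u' := by
    rw [← real_inner_smul_right, ← real_inner_smul_right, e]
  have h4 : |c| = |c'| := by
    have := congrArg norm e
    rw [norm_smul, norm_smul, hu.2.1, hu'.2.1] at this
    simpa using this
  have hcc : c = c' := by
    rcases abs_eq_abs.mp h4 with h5 | h5
    · exact h5
    · subst h5
      have : c' * (inner ℝ p u + inner ℝ p u') = 0 := by linarith
      rcases mul_eq_zero.mp this with h6 | h6
      · exact absurd h6 hc'
      · linarith
  subst hcc
  exact smul_right_injective _ hc e

/-- A map that is nondegenerate only tangentially becomes injective after a suitable correction in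
the normal direction. -/
theorem exists_injective_add_smul_of_tangentialDet_ne_zero {u : EuclideanSpace ℝ (Fin (n + 1))}
    (hu : ‖u‖ = 1) {L : EuclideanSpace ℝ (Fin (n + 1)) →L[ℝ] EuclideanSpace ℝ (Fin (n + 1))}
    (hL : tangentialDet u L ≠ 0) :
    ∃ μ : ℝ, ∀ v, L v + (μ * inner ℝ u v) • u = 0 → v = 0 := by
  set S := (ℝ ∙ u)ᗮ
  set M : S →ₗ[ℝ] S := ((S.orthogonalProjectionOnto ∘L L ∘L S.subtypeL : S →L[ℝ] S) : S →ₗ[ℝ] S)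
    with hM
  have hMdet : IsUnit M.det := isUnit_iff_ne_zero.mpr hL
  let e := LinearEquiv.ofIsUnitDet (v := Module.finBasis ℝ S) (v' := Module.finBasis ℝ S)
    (f := M) (by rwa [LinearMap.det_toMatrix])
  have he : ∀ s, e s = M s := fun s => rfl
  have hMs : ∀ s : S, M s = S.orthogonalProjectionOnto (L s) := fun s => rfl
  set s0 : S := e.symm (S.orthogonalProjectionOnto (L u)) with hs0
  have hMs0 : M s0 = S.orthogonalProjectionOnto (L u) := by
    rw [← he, hs0, e.apply_symm_apply]
  have huS : S.orthogonalProjectionOnto u = 0 := by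
    rw [Submodule.orthogonalProjectionOnto_eq_zero_iff, Submodule.orthogonal_orthogonal]
    exact Submodule.mem_span_singleton_self u
  -- Projecting to `u^⊥` forces a kernel vector to be `a (u - s0)`. Pairing with `u` leaves `a (⟨u,
  -- L (u - s0)⟩ + μ) = 0`, and this `μ` makes the bracket equal to 1.
  refine ⟨1 - inner ℝ u (L (u - s0)), fun v hv => ?_⟩
  set a : ℝ := inner ℝ u v with ha
  have hvS : v - a • u ∈ S := by
    rw [Submodule.mem_orthogonal_singleton_iff_inner_right, inner_sub_right, real_inner_smul_right,
      real_inner_self_eq_norm_sq, hu]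
    ring
  set s : S := ⟨v - a • u, hvS⟩ with hs
  have hvdec : v = a • u + s := by simp [hs]
  have h1 := congrArg S.orthogonalProjectionOnto hv
  rw [map_add, map_smul, huS, smul_zero, add_zero, map_zero] at h1
  rw [hvdec, map_add, map_add, map_smul, map_smul, ← hMs, ← hMs0, ← map_smul, ← map_add, ← he,
    map_eq_zero_iff _ e.injective] at h1
  have h2 : v = a • (u - s0) := by
    have : (a • (s0 : EuclideanSpace ℝ (Fin (n + 1))) + s) = 0 := by
      simpa using congrArg Subtype.val h1
    rw [hvdec, smul_sub, eq_neg_of_add_eq_zero_right this]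
    abel
  have h3 := congrArg (fun w => inner ℝ u w) hv
  simp only [inner_add_right, real_inner_smul_right, inner_zero_right,
    real_inner_self_eq_norm_sq, hu] at h3
  rw [h2, map_smul, real_inner_smul_right] at h3
  have h4 : a = 0 := by linarith
  rw [h2, h4, zero_smul]

/-- The gradient inverts the Gauss map, but the ambient extension `N` need not have invertible
differential. The field `Φ = (1 + (μ/c) f) N` agrees with `N` on `∂K` and its differential at `p`
gains the term `μ ⟨x, ·⟩ x`, so it has a smooth local inverse `g`. Then `X z = g(z/|z|)` near `y`,
where continuity of `X` keeps `X z` in the domain of inversion. -/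
theorem contDiffAt_gradient_supportFunction (hK : IsSmoothStrictlyConvexBody K)
    {y : EuclideanSpace ℝ (Fin (n + 1))} (hy : y ≠ 0) :
    ContDiffAt ℝ ∞ (gradient (supportFunction K)) y := by
  obtain ⟨hc, hs, h0, hsm, hcurv⟩ := hK
  have hne : K.Nonempty := ⟨0, interior_subset h0⟩
  set X := gradient (supportFunction K) with hX
  set p := X y with hp
  have hXf : ∀ z, z ≠ 0 → X z ∈ frontier K := fun z hz =>
    mem_frontier_of_inner_eq_supportFunction hc (gradient_supportFunction_mem hc hs hne hz) hz
      (inner_gradient_supportFunction hc hs hne hz)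
  obtain ⟨κ, hκ, U₁, N, hU₁, hpU₁, hN, hNn, hκN⟩ := hcurv p (hXf y hy)
  obtain ⟨U₂, f, hU₂, hpU₂, hf, hf', hfU⟩ := hsm p (hXf y hy)
  set x := ‖y‖⁻¹ • y with hx
  have hnorm : IsOuterUnitNormal K p x := isOuterUnitNormal_gradient hc hs hne hy
  have hNx : ∀ z, z ≠ 0 → X z ∈ U₁ → N (X z) = ‖z‖⁻¹ • z := fun z hz hzU =>
    IsOuterUnitNormal.unique hc h0 hsm (hXf z hz) (hNn _ ⟨hXf z hz, hzU⟩)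
      (isOuterUnitNormal_gradient hc hs hne hz)
  have hf0 : ∀ z, z ≠ 0 → X z ∈ U₂ → f (X z) = 0 := by
    intro z hz hzU
    have : X z ∈ {q | q ∈ U₂ ∧ f q = 0} := hfU ▸ ⟨hXf z hz, hzU⟩
    exact this.2
  obtain ⟨c, hc0, hfc⟩ := exists_fderiv_eq_mul_inner hc.isClosed hnorm (hXf y hy) hU₂ hpU₂ hf
    (hf' p hpU₂) hfU
  rw [hNx y hy hpU₁] at hκN
  obtain ⟨μ, hμ⟩ := exists_injective_add_smul_of_tangentialDet_ne_zero hnorm.2.1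
    (hκN ▸ hκ.ne' : tangentialDet x (fderiv ℝ N p) ≠ 0)
  set Φ : EuclideanSpace ℝ (Fin (n + 1)) → EuclideanSpace ℝ (Fin (n + 1)) :=
    fun q => (1 + μ / c * f q) • N q with hΦ
  have hNat : ContDiffAt ℝ ∞ N p := hN.contDiffAt (hU₁.mem_nhds hpU₁)
  have hfat : ContDiffAt ℝ ∞ f p := hf.contDiffAt (hU₂.mem_nhds hpU₂)
  have hΦat : ContDiffAt ℝ ∞ Φ p := (contDiffAt_const.add (contDiffAt_const.mul hfat)).smul hNat
  have hΦ' : HasFDerivAt Φ ((1 + μ / c * f p) • fderiv ℝ N p +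
      ((μ / c) • fderiv ℝ f p).smulRight (N p)) p := by
    have h1 := (((hfat.differentiableAt (by simp)).hasFDerivAt.const_mul (μ / c)).const_add 1)
    exact h1.smul (hNat.differentiableAt (by simp)).hasFDerivAt
  set L := (1 + μ / c * f p) • fderiv ℝ N p + ((μ / c) • fderiv ℝ f p).smulRight (N p) with hL
  have hinj : Function.Injective L := by
    rw [injective_iff_map_eq_zero]
    intro v hv
    refine hμ v ?_
    rw [hL, hf0 y hy hpU₂, hNx y hy hpU₁] at hv
    simp only [mul_zero, add_zero, one_smul, add_apply,
      ContinuousLinearMap.smulRight_apply, smul_apply, smul_eq_mul, hfc] at hv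
    rw [← hv]
    congr 2
    field_simp
  let e : EuclideanSpace ℝ (Fin (n + 1)) ≃L[ℝ] EuclideanSpace ℝ (Fin (n + 1)) :=
    (LinearEquiv.ofInjectiveEndo (L : EuclideanSpace ℝ (Fin (n + 1)) →ₗ[ℝ]
      EuclideanSpace ℝ (Fin (n + 1))) hinj).toContinuousLinearEquiv
  have hΦe : HasFDerivAt Φ (e : EuclideanSpace ℝ (Fin (n + 1)) →L[ℝ]
      EuclideanSpace ℝ (Fin (n + 1))) p := by
    convert hΦ' using 1
    ext1 v
    rfl
  have hΦp : Φ p = x := by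
    simp only [hΦ, hp, hf0 y hy hpU₂, hNx y hy hpU₁]
    simp [hx]
  have hginv := hΦat.to_localInverse hΦe (by simp)
  have hleft := (hΦat.hasStrictFDerivAt' hΦe (by simp)).eventually_left_inverse
  set g := hΦat.localInverse hΦe (by simp) with hg
  rw [hΦp] at hginv
  have hXc : ContinuousAt X y := continuousAt_gradient_supportFunction hc hs hne hy
  have hcomp : ContDiffAt ℝ ∞ (fun z : EuclideanSpace ℝ (Fin (n + 1)) => g (‖z‖⁻¹ • z)) y := by
    refine ContDiffAt.comp y hginv ?_
    exact ((contDiffAt_norm ℝ hy).inv (norm_ne_zero_iff.mpr hy)).smul contDiffAt_id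
  refine hcomp.congr_of_eventuallyEq ?_
  filter_upwards [isOpen_ne.mem_nhds hy, hXc.tendsto (hU₁.mem_nhds hpU₁),
    hXc.tendsto (hU₂.mem_nhds hpU₂), hXc.tendsto hleft] with z hz hz1 hz2 hz3
  have h5 : Φ (X z) = ‖z‖⁻¹ • z := by
    simp only [hΦ, hf0 z hz hz2, hNx z hz hz1]
    simp
  rw [← h5]
  exact hz3.symm

end Regularity

/-! ### The determinant of `h A + g ⊗ g`. -/

section RankOne

/-- The operator preserves `W = x^⊥`, acting there as `a M`, and acts as `b` on the one-dimensional
quotient. -/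
theorem det_smul_add_smulRight_self {E : Type*} [NormedAddCommGroup E] [InnerProductSpace ℝ E]
    [FiniteDimensional ℝ E] {x : E} (hx : ‖x‖ = 1) (A : E →ₗ[ℝ] E) (hA : ∀ v, inner ℝ x (A v) = 0)
    (a b : ℝ) {W : Submodule ℝ E} (hWx : W = (ℝ ∙ x)ᗮ) (M : W →ₗ[ℝ] W)
    (hM : ∀ v, (M v : E) = A v) :
    LinearMap.det (a • A + (b • (innerₗ E x)).smulRight x)
      = a ^ Module.finrank ℝ W * M.det * b := by
  set C := a • A + (b • (innerₗ E x)).smulRight x with hC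
  have hW : ∀ v, v ∈ W ↔ inner ℝ x v = 0 := fun v => by
    rw [hWx, Submodule.mem_orthogonal_singleton_iff_inner_right]
  have hxC : ∀ v, inner ℝ x (C v) = b * inner ℝ x v := by
    intro v
    simp [hC, inner_add_right, real_inner_smul_right, hA, hx]
  have hCW : W ≤ W.comap C := by
    intro v hv
    rw [Submodule.mem_comap, hW, hxC, (hW v).mp hv, mul_zero]
  rw [LinearMap.det_eq_det_mul_det W C hCW]
  have h1 : C.restrict hCW = a • M := by
    ext v
    have hv : inner ℝ x (v : E) = 0 := (hW v).mp v.2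
    simp [hC, hM, hv]
  have h2 : W.mapQ W C hCW = b • LinearMap.id := by
    refine Submodule.linearMap_qext _ (LinearMap.ext fun v => ?_)
    simp only [LinearMap.comp_apply, Submodule.mkQ_apply, Submodule.mapQ_apply,
      LinearMap.smul_apply, LinearMap.id_apply]
    rw [← Submodule.Quotient.mk_smul, Submodule.Quotient.eq, hW, inner_sub_right, hxC,
      real_inner_smul_right, sub_self]
  have h3 : Module.finrank ℝ (E ⧸ W) = 1 := by
    have e1 := Submodule.finrank_quotient_add_finrank W
    have e2 := Submodule.finrank_add_finrank_orthogonal (ℝ ∙ x)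
    rw [finrank_span_singleton (norm_ne_zero_iff.mp (by simp [hx])), ← hWx] at e2
    omega
  rw [h1, h2, LinearMap.det_smul, LinearMap.det_smul, h3, LinearMap.det_id]
  ring

/-- Write `g = h (x + g')` with `g' ⊥ x`. Since `A x = 0` and the image of `A` is orthogonal to `x`,
two transvections, of determinant 1, reduce `g ⊗ g` to `h² x ⊗ x`. -/
theorem det_smul_add_smulRight {E : Type*} [NormedAddCommGroup E] [InnerProductSpace ℝ E]
    [FiniteDimensional ℝ E] {x : E} (hx : ‖x‖ = 1) (A : E →ₗ[ℝ] E) (hA : ∀ v, inner ℝ x (A v) = 0)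
    (hAx : A x = 0) {h : ℝ} (hh : h ≠ 0) {g : E} (hg : inner ℝ x g = h)
    (M : (ℝ ∙ x)ᗮ →ₗ[ℝ] (ℝ ∙ x)ᗮ) (hM : ∀ v, (M v : E) = A v) :
    LinearMap.det (h • A + (innerₗ E g).smulRight g)
      = h ^ (Module.finrank ℝ (ℝ ∙ x)ᗮ + 2) * M.det := by
  set g' := h⁻¹ • g - x with hg'
  have hxx : inner ℝ x x = (1 : ℝ) := by rw [real_inner_self_eq_norm_sq, hx, one_pow]
  have hxg' : inner ℝ x g' = 0 := by
    rw [hg', inner_sub_right, real_inner_smul_right, hg, hxx, inv_mul_cancel₀ hh, sub_self]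
  have key : h • A + (innerₗ E g).smulRight g
      = LinearMap.transvection (innerₗ E x) g' ∘ₗ (h • A + (h ^ 2 • (innerₗ E x)).smulRight x) ∘ₗ
        LinearMap.transvection (innerₗ E g') x := by
    ext v
    simp only [LinearMap.add_apply, LinearMap.smul_apply, LinearMap.smulRight_apply,
      LinearMap.comp_apply, LinearMap.transvection.apply, innerₗ_apply_apply, map_add, map_smul,
      hAx, smul_zero, hA, hxx, mul_one, zero_add, smul_eq_mul]
    have hgv : inner ℝ g v = h * (inner ℝ x v + inner ℝ g' v) := by
      rw [hg', inner_sub_left, real_inner_smul_left]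
      field_simp
      ring
    have hgg : g = h • (x + g') := by
      rw [hg', add_sub_cancel, smul_smul, mul_inv_cancel₀ hh, one_smul]
    rw [hgv, hgg]
    module
  rw [key, LinearMap.det_comp, LinearMap.det_comp, LinearMap.transvection.det,
    LinearMap.transvection.det, det_smul_add_smulRight_self hx A hA h (h ^ 2) rfl M hM,
    innerₗ_apply_apply, innerₗ_apply_apply, real_inner_comm x g', hxg']
  ring

end RankOne

/-! ### The map `T = ∇(h²/2)` and its differential. -/

section DualityMap

open Filter Topology

variable {n : ℕ}

/-- Half the square of the support function. -/
noncomputable def halfSqSupport (K : Set (EuclideanSpace ℝ (Fin (n + 1))))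
    (y : EuclideanSpace ℝ (Fin (n + 1))) : ℝ :=
  supportFunction K y ^ 2 / 2

/-- The Hessian of the support function. -/
noncomputable def supportHessian (K : Set (EuclideanSpace ℝ (Fin (n + 1))))
    (y : EuclideanSpace ℝ (Fin (n + 1))) :
    EuclideanSpace ℝ (Fin (n + 1)) →L[ℝ] EuclideanSpace ℝ (Fin (n + 1)) :=
  fderiv ℝ (gradient (supportFunction K)) y

/-- The gradient of half the square of the support function. -/
noncomputable def dualityMap (K : Set (EuclideanSpace ℝ (Fin (n + 1))))
    (y : EuclideanSpace ℝ (Fin (n + 1))) : EuclideanSpace ℝ (Fin (n + 1)) :=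
  supportFunction K y • gradient (supportFunction K) y

/-- The Hessian of half the square of the support function. -/
noncomputable def dualityHessian (K : Set (EuclideanSpace ℝ (Fin (n + 1))))
    (y : EuclideanSpace ℝ (Fin (n + 1))) :
    EuclideanSpace ℝ (Fin (n + 1)) →L[ℝ] EuclideanSpace ℝ (Fin (n + 1)) :=
  supportFunction K y • supportHessian K y +
    (innerSL ℝ (gradient (supportFunction K) y)).smulRight (gradient (supportFunction K) y)

namespace IsSmoothStrictlyConvexBody

variable {K : Set (EuclideanSpace ℝ (Fin (n + 1)))} (hK : IsSmoothStrictlyConvexBody K)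
  {y : EuclideanSpace ℝ (Fin (n + 1))}
include hK

theorem nonempty : K.Nonempty := ⟨0, interior_subset hK.zero_mem_interior⟩

theorem hasFDerivAt_gradient (hy : y ≠ 0) :
    HasFDerivAt (gradient (supportFunction K)) (supportHessian K y) y :=
  ((contDiffAt_gradient_supportFunction hK hy).differentiableAt (by simp)).hasFDerivAt

theorem hasFDerivAt_supportFunction (hy : y ≠ 0) :
    HasFDerivAt (supportFunction K) (innerSL ℝ (gradient (supportFunction K) y)) y := by
  have := hasGradientAt_supportFunction hK.isCompact hK.strictConvex hK.nonempty hy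
  exact this.hasFDerivAt

theorem hasFDerivAt_halfSqSupport (hy : y ≠ 0) :
    HasFDerivAt (halfSqSupport K) (innerSL ℝ (dualityMap K y)) y := by
  have h := ((hK.hasFDerivAt_supportFunction hy).pow 2).mul_const (2 : ℝ)⁻¹
  simp only [← div_eq_mul_inv] at h
  refine h.congr_fderiv ?_
  ext v
  simp [dualityMap]
  ring

theorem hasFDerivAt_dualityMap (hy : y ≠ 0) :
    HasFDerivAt (dualityMap K) (dualityHessian K y) y :=
  (hK.hasFDerivAt_supportFunction hy).smul (hK.hasFDerivAt_gradient hy)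

theorem gradient_smul (hy : y ≠ 0) {c : ℝ} (hc : 0 < c) :
    gradient (supportFunction K) (c • y) = gradient (supportFunction K) y :=
  gradient_supportFunction_smul hK.isCompact hK.strictConvex hK.nonempty hy hc

theorem support_smul {c : ℝ} (hc : 0 ≤ c) (y : EuclideanSpace ℝ (Fin (n + 1))) :
    supportFunction K (c • y) = c * supportFunction K y :=
  supportFunction_smul hK.isCompact hK.nonempty hc y

theorem support_pos (hy : y ≠ 0) : 0 < supportFunction K y :=
  supportFunction_pos hK.isCompact hK.zero_mem_interior hy

theorem inner_gradient (hy : y ≠ 0) :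
    inner ℝ (gradient (supportFunction K) y) y = supportFunction K y :=
  inner_gradient_supportFunction hK.isCompact hK.strictConvex hK.nonempty hy

theorem gradient_mem (hy : y ≠ 0) : gradient (supportFunction K) y ∈ K :=
  gradient_supportFunction_mem hK.isCompact hK.strictConvex hK.nonempty hy

theorem gradient_ne_zero (hy : y ≠ 0) : gradient (supportFunction K) y ≠ 0 := by
  intro h
  have := hK.inner_gradient hy
  rw [h, inner_zero_left] at this
  exact (hK.support_pos hy).ne this

theorem supportHessian_self (hy : y ≠ 0) : supportHessian K y y = 0 := by
  have h1 : HasDerivAt (fun t : ℝ => gradient (supportFunction K) ((1 + t) • y))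
      (supportHessian K y y) 0 := by
    have h2 : HasDerivAt (fun t : ℝ => (1 + t) • y) y 0 := by
      simpa using ((hasDerivAt_id (0 : ℝ)).const_add 1).smul_const y
    have h3 : HasFDerivAt (gradient (supportFunction K)) (supportHessian K y)
        ((1 + (0 : ℝ)) • y) := by simpa using hK.hasFDerivAt_gradient hy
    exact h3.comp_hasDerivAt 0 h2
  have h4 : HasDerivAt (fun t : ℝ => gradient (supportFunction K) ((1 + t) • y)) 0 0 := by
    refine (hasDerivAt_const 0 (gradient (supportFunction K) y)).congr_of_eventuallyEq ?_
    filter_upwards [lt_mem_nhds (show (-1 : ℝ) < 0 by norm_num)] with t ht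
    exact hK.gradient_smul hy (by linarith)
  exact h1.unique h4

theorem supportHessian_smul (hy : y ≠ 0) {c : ℝ} (hc : 0 < c) :
    supportHessian K (c • y) = c⁻¹ • supportHessian K y := by
  have h1 : HasFDerivAt (fun z => gradient (supportFunction K) (c • z))
      (supportHessian K (c • y) ∘L (c • ContinuousLinearMap.id ℝ _)) y :=
    (hK.hasFDerivAt_gradient (smul_ne_zero hc.ne' hy)).comp y ((hasFDerivAt_id y).const_smul c)
  have h2 : HasFDerivAt (fun z => gradient (supportFunction K) (c • z)) (supportHessian K y) y := by
    refine (hK.hasFDerivAt_gradient hy).congr_of_eventuallyEq ?_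
    filter_upwards [isOpen_ne.mem_nhds hy] with z hz
    exact hK.gradient_smul hz hc
  rw [← h1.unique h2]
  ext v
  simp [hc.ne']

theorem inner_supportHessian_comm (hy : y ≠ 0) (v w : EuclideanSpace ℝ (Fin (n + 1))) :
    inner ℝ (supportHessian K y v) w = inner ℝ (supportHessian K y w) v := by
  have h1 : ∀ᶠ z in 𝓝 y, HasFDerivAt (supportFunction K)
      ((innerSL ℝ : EuclideanSpace ℝ (Fin (n + 1)) →L[ℝ] EuclideanSpace ℝ (Fin (n + 1)) →L[ℝ] ℝ)
        (gradient (supportFunction K) z)) z := by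
    filter_upwards [isOpen_ne.mem_nhds hy] with z hz
    exact hK.hasFDerivAt_supportFunction hz
  have h2 := ((innerSL ℝ : EuclideanSpace ℝ (Fin (n + 1)) →L[ℝ]
    EuclideanSpace ℝ (Fin (n + 1)) →L[ℝ] ℝ).hasFDerivAt).comp y (hK.hasFDerivAt_gradient hy)
  exact second_derivative_symmetric_of_eventually h1 h2 v w

theorem inner_self_supportHessian (hy : y ≠ 0) (v : EuclideanSpace ℝ (Fin (n + 1))) :
    inner ℝ y (supportHessian K y v) = 0 := by
  rw [real_inner_comm, hK.inner_supportHessian_comm hy, hK.supportHessian_self hy, inner_zero_left]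

/-- The contact points are monotone in the direction: `⟨X(y + tv) - X y, tv⟩ ≥ 0`. -/
theorem inner_supportHessian_self_nonneg (hy : y ≠ 0) (v : EuclideanSpace ℝ (Fin (n + 1))) :
    0 ≤ inner ℝ (supportHessian K y v) v := by
  have h2 : HasDerivAt (fun t : ℝ => y + t • v) v 0 := by
    simpa using ((hasDerivAt_id (0 : ℝ)).smul_const v).const_add y
  have h3 : HasFDerivAt (gradient (supportFunction K)) (supportHessian K y)
      (y + (0 : ℝ) • v) := by simpa using hK.hasFDerivAt_gradient hy
  have h4 := (h3.comp_hasDerivAt 0 h2).inner ℝ (hasDerivAt_const (0 : ℝ) v)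
  have h5 := h4.tendsto_slope_zero_right
  simp only [Function.comp_apply, inner_zero_right, zero_add, zero_smul, add_zero] at h5
  refine ge_of_tendsto h5 ?_
  have h6 : ∀ᶠ t : ℝ in 𝓝[>] 0, y + t • v ≠ 0 := by
    have : Tendsto (fun t : ℝ => y + t • v) (𝓝 0) (𝓝 y) := by
      simpa using h2.continuousAt.tendsto
    exact (this.mono_left nhdsWithin_le_nhds).eventually (isOpen_ne.mem_nhds hy)
  filter_upwards [h6, self_mem_nhdsWithin] with t ht ht0
  have ht0 : 0 < t := ht0
  have e1 := hK.inner_gradient hy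
  have e2 := hK.inner_gradient ht
  have e3 := inner_le_supportFunction hK.isCompact (hK.gradient_mem hy) (y + t • v)
  have e4 := inner_le_supportFunction hK.isCompact (hK.gradient_mem ht) y
  rw [inner_add_right, real_inner_smul_right] at e2 e3
  have e5 : 0 ≤ t * (inner ℝ (gradient (supportFunction K) (y + t • v)) v
      - inner ℝ (gradient (supportFunction K) y) v) := by linarith
  rw [smul_eq_mul]
  exact mul_nonneg (inv_nonneg.mpr ht0.le) (nonneg_of_mul_nonneg_right e5 ht0)

theorem dualityMap_smul (hy : y ≠ 0) {c : ℝ} (hc : 0 < c) :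
    dualityMap K (c • y) = c • dualityMap K y := by
  rw [dualityMap, dualityMap, hK.gradient_smul hy hc, hK.support_smul hc.le, mul_smul]

theorem dualityHessian_smul (hy : y ≠ 0) {c : ℝ} (hc : 0 < c) :
    dualityHessian K (c • y) = dualityHessian K y := by
  rw [dualityHessian, dualityHessian, hK.gradient_smul hy hc, hK.support_smul hc.le,
    hK.supportHessian_smul hy hc, smul_smul]
  congr 2
  field_simp

/-- This turns the curvature equation into a Monge–Ampère equation for `h²/2`. -/
theorem det_dualityHessian (hy : ‖y‖ = 1) :
    (dualityHessian K y).det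
      = supportFunction K y ^ (n + 2) * tangentialDet y (supportHessian K y) := by
  have hy0 : y ≠ 0 := norm_ne_zero_iff.mp (by simp [hy])
  have hM : ∀ v : (ℝ ∙ y)ᗮ, (((((ℝ ∙ y)ᗮ.orthogonalProjectionOnto ∘L supportHessian K y ∘L
      (ℝ ∙ y)ᗮ.subtypeL : (ℝ ∙ y)ᗮ →L[ℝ] (ℝ ∙ y)ᗮ) : (ℝ ∙ y)ᗮ →ₗ[ℝ] (ℝ ∙ y)ᗮ) v :
      (ℝ ∙ y)ᗮ) : EuclideanSpace ℝ (Fin (n + 1))) = supportHessian K y v := by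
    intro v
    have : supportHessian K y v ∈ (ℝ ∙ y)ᗮ :=
      Submodule.mem_orthogonal_singleton_iff_inner_right.mpr
        (hK.inner_self_supportHessian hy0 v)
    simp only [ContinuousLinearMap.coe_coe, ContinuousLinearMap.comp_apply,
      Submodule.subtypeL_apply]
    exact congrArg Subtype.val (Submodule.orthogonalProjectionOnto_mem_subspace_eq_self ⟨_, this⟩)
  have key := det_smul_add_smulRight hy (supportHessian K y).toLinearMap
    (hK.inner_self_supportHessian hy0) (hK.supportHessian_self hy0) (hK.support_pos hy0).ne'
    (g := gradient (supportFunction K) y)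
    (by rw [real_inner_comm, hK.inner_gradient hy0]) _ hM
  have : Fact (Module.finrank ℝ (EuclideanSpace ℝ (Fin (n + 1))) = n + 1) := ⟨by simp⟩
  rw [Submodule.finrank_orthogonal_span_singleton (n := n) hy0] at key
  rw [tangentialDet, ← key, ContinuousLinearMap.det]
  rfl

end IsSmoothStrictlyConvexBody

end DualityMap

/-! ### Bijectivity, growth and convexity estimates for `T` and `H`. -/

section DualityMapGlobal

open Filter Topology

variable {n : ℕ}

theorem exists_norm_le_of_zero_homogeneous {F : Type*} [NormedAddCommGroup F]
    {f : EuclideanSpace ℝ (Fin (n + 1)) → F} (hf : ContinuousOn f {0}ᶜ)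
    (hom : ∀ y, y ≠ 0 → ∀ c : ℝ, 0 < c → f (c • y) = f y) :
    ∃ C : ℝ, 0 ≤ C ∧ ∀ y, y ≠ 0 → ‖f y‖ ≤ C := by
  have hcomp : IsCompact (Metric.sphere (0 : EuclideanSpace ℝ (Fin (n + 1))) 1) :=
    isCompact_sphere _ _
  obtain ⟨C, hC⟩ := hcomp.exists_bound_of_continuousOn (f := f) (hf.mono fun y hy => by
    rintro rfl
    simp at hy)
  refine ⟨max C 0, le_max_right _ _, fun y hy => ?_⟩
  rw [← hom y hy ‖y‖⁻¹ (by positivity)]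
  exact (hC _ (by simpa using norm_smul_inv_norm (𝕜 := ℝ) hy)).trans (le_max_left _ _)

namespace IsSmoothStrictlyConvexBody

variable {K : Set (EuclideanSpace ℝ (Fin (n + 1)))} (hK : IsSmoothStrictlyConvexBody K)
  {y : EuclideanSpace ℝ (Fin (n + 1))}
include hK

theorem continuous_support : Continuous (supportFunction K) :=
  continuous_supportFunction hK.isCompact hK.nonempty

theorem continuous_halfSqSupport : Continuous (halfSqSupport K) := by
  have := hK.continuous_support
  unfold halfSqSupport
  fun_prop

theorem continuousAt_supportHessian (hy : y ≠ 0) : ContinuousAt (supportHessian K) y :=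
  ((contDiffAt_gradient_supportFunction hK hy).fderiv_right (m := 0) (by simp)).continuousAt

theorem continuousAt_gradient (hy : y ≠ 0) : ContinuousAt (gradient (supportFunction K)) y :=
  (hK.hasFDerivAt_gradient hy).continuousAt

theorem continuousOn_dualityMap : ContinuousOn (dualityMap K) {0}ᶜ := fun _ hy =>
  (hK.hasFDerivAt_dualityMap hy).continuousAt.continuousWithinAt

theorem continuousOn_dualityHessian : ContinuousOn (dualityHessian K) {0}ᶜ := by
  intro y hy
  have h1 := hK.continuousAt_supportHessian hy
  have h2 := hK.continuousAt_gradient hy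
  have h3 := hK.continuous_support.continuousAt (x := y)
  have h4 : Continuous fun v : EuclideanSpace ℝ (Fin (n + 1)) => (innerSL ℝ v).smulRight v := by
    have h5 : Continuous fun v : EuclideanSpace ℝ (Fin (n + 1)) =>
        ContinuousLinearMap.smulRightL ℝ (EuclideanSpace ℝ (Fin (n + 1)))
          (EuclideanSpace ℝ (Fin (n + 1))) (innerSL ℝ v) v := by fun_prop
    exact h5
  have h6 := ContinuousAt.comp (f := gradient (supportFunction K)) (x := y) h4.continuousAt h2
  exact ((h3.smul h1).add h6).continuousWithinAt

theorem exists_lower_bound : ∃ c : ℝ, 0 < c ∧ ∀ y, c * ‖y‖ ≤ supportFunction K y := by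
  obtain ⟨r, hr, hrK⟩ := Metric.nhds_basis_closedBall.mem_iff.mp
    (mem_interior_iff_mem_nhds.mp hK.zero_mem_interior)
  refine ⟨r, hr, fun y => ?_⟩
  rcases eq_or_ne y 0 with rfl | hy
  · simp [supportFunction_zero hK.isCompact hK.nonempty]
  · have h1 : (r * ‖y‖⁻¹) • y ∈ K := hrK (by
      have : ‖y‖ ≠ 0 := norm_ne_zero_iff.mpr hy
      simp [norm_smul, abs_of_pos hr, this])
    have h2 := inner_le_supportFunction hK.isCompact h1 y
    rw [real_inner_smul_left, real_inner_self_eq_norm_sq] at h2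
    have : ‖y‖ ≠ 0 := norm_ne_zero_iff.mpr hy
    calc r * ‖y‖ = r * ‖y‖⁻¹ * ‖y‖ ^ 2 := by field_simp
      _ ≤ _ := h2

theorem exists_lower_bound_halfSqSupport :
    ∃ c : ℝ, 0 < c ∧ ∀ y, c * ‖y‖ ^ 2 ≤ halfSqSupport K y := by
  obtain ⟨c, hc, h⟩ := hK.exists_lower_bound
  refine ⟨c ^ 2 / 2, by positivity, fun y => ?_⟩
  have := pow_le_pow_left₀ (by positivity) (h y) 2
  rw [halfSqSupport]
  linarith [mul_pow c ‖y‖ 2]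

theorem dualityMap_zero : dualityMap K 0 = 0 := by
  rw [dualityMap, supportFunction_zero hK.isCompact hK.nonempty, zero_smul]

theorem halfSqSupport_zero : halfSqSupport K 0 = 0 := by
  simp [halfSqSupport, supportFunction_zero hK.isCompact hK.nonempty]

theorem exists_dualityMap_bound : ∃ C : ℝ, 0 ≤ C ∧ ∀ y, ‖dualityMap K y‖ ≤ C * ‖y‖ := by
  obtain ⟨C, hC, h⟩ := exists_norm_le_of_zero_homogeneous
    (f := fun y => ‖y‖⁻¹ • dualityMap K y) (by
      have h1 : ContinuousOn (fun y : EuclideanSpace ℝ (Fin (n + 1)) => ‖y‖⁻¹) {0}ᶜ :=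
        continuousOn_id.norm.inv₀ fun y hy => norm_ne_zero_iff.mpr hy
      exact h1.smul hK.continuousOn_dualityMap)
    (fun y hy c hc => by
      rw [hK.dualityMap_smul hy hc, norm_smul, smul_smul, Real.norm_of_nonneg hc.le]
      congr 1
      field_simp)
  refine ⟨C, hC, fun y => ?_⟩
  rcases eq_or_ne y 0 with rfl | hy
  · simp [hK.dualityMap_zero]
  · have := h y hy
    rw [norm_smul, norm_inv, norm_norm, inv_mul_le_iff₀ (norm_pos_iff.mpr hy)] at this
    linarith

theorem exists_dualityHessian_bound :
    ∃ C : ℝ, 0 ≤ C ∧ ∀ y, y ≠ 0 → ‖dualityHessian K y‖ ≤ C :=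
  exists_norm_le_of_zero_homogeneous hK.continuousOn_dualityHessian
    fun _ hy _ hc => hK.dualityHessian_smul hy hc

theorem continuousOn_det_dualityHessian :
    ContinuousOn (fun y => |(dualityHessian K y).det|) {0}ᶜ :=
  (ContinuousLinearMap.continuous_det.comp_continuousOn hK.continuousOn_dualityHessian).abs

theorem exists_det_bound :
    ∃ C : ℝ, 0 ≤ C ∧ ∀ y, y ≠ 0 → |(dualityHessian K y).det| ≤ C := by
  obtain ⟨C, hC, h⟩ := exists_norm_le_of_zero_homogeneous hK.continuousOn_det_dualityHessian
    fun y hy c hc => by rw [hK.dualityHessian_smul hy hc]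
  exact ⟨C, hC, fun y hy => by simpa using h y hy⟩

theorem gradient_mem_frontier (hy : y ≠ 0) : gradient (supportFunction K) y ∈ frontier K :=
  mem_frontier_of_inner_eq_supportFunction hK.isCompact (hK.gradient_mem hy) hy
    (hK.inner_gradient hy)

theorem mem_nhds_zero : K ∈ 𝓝 (0 : EuclideanSpace ℝ (Fin (n + 1))) :=
  mem_interior_iff_mem_nhds.mp hK.zero_mem_interior

/-- Contact points have gauge 1. In terms of the Legendre transform `H* = gauge²/2`, this is `H*(T
y) = H(y)`. -/
theorem gauge_dualityMap (y : EuclideanSpace ℝ (Fin (n + 1))) :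
    gauge K (dualityMap K y) = supportFunction K y := by
  rcases eq_or_ne y 0 with rfl | hy
  · rw [hK.dualityMap_zero, gauge_zero, supportFunction_zero hK.isCompact hK.nonempty]
  · rw [dualityMap, gauge_smul_of_nonneg (hK.support_pos hy).le,
      (gauge_eq_one_iff_mem_frontier hK.strictConvex.convex hK.mem_nhds_zero).mpr
        (hK.gradient_mem_frontier hy)]
    simp

theorem dualityMap_ne_zero (hy : y ≠ 0) : dualityMap K y ≠ 0 :=
  smul_ne_zero (hK.support_pos hy).ne' (hK.gradient_ne_zero hy)

/-- The gauge of `T y` recovers `h y`, hence `X y`, hence the direction of `y` by uniqueness of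
normals; homogeneity of `h` then gives the length. -/
theorem injOn_dualityMap : InjOn (dualityMap K) {0}ᶜ := by
  intro y hy z hz h
  have h1 : supportFunction K y = supportFunction K z := by
    rw [← hK.gauge_dualityMap, ← hK.gauge_dualityMap, h]
  have h2 : gradient (supportFunction K) y = gradient (supportFunction K) z := by
    rw [dualityMap, dualityMap, h1] at h
    exact smul_right_injective _ (hK.support_pos hz).ne' h
  have h3 := isOuterUnitNormal_gradient hK.isCompact hK.strictConvex hK.nonempty hy
  have h4 := isOuterUnitNormal_gradient hK.isCompact hK.strictConvex hK.nonempty hz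
  rw [h2] at h3
  have h5 := h3.unique hK.isCompact hK.zero_mem_interior hK.smooth (hK.gradient_mem_frontier hz) h4
  have h6 := congrArg (supportFunction K) h5
  have hy' : 0 < ‖y‖ := norm_pos_iff.mpr hy
  have hz' : 0 < ‖z‖ := norm_pos_iff.mpr hz
  rw [hK.support_smul (by positivity), hK.support_smul (by positivity), h1] at h6
  have h7 := mul_right_cancel₀ (hK.support_pos hz).ne' h6
  rw [h7] at h5
  exact smul_right_injective _ (by positivity) h5

theorem image_dualityMap : dualityMap K '' {0}ᶜ = {0}ᶜ := by
  refine Subset.antisymm ?_ fun m hm => ?_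
  · rintro _ ⟨y, hy, rfl⟩
    exact hK.dualityMap_ne_zero hy
  · have habs : Absorbent ℝ K := absorbent_nhds_zero hK.mem_nhds_zero
    have hg : 0 < gauge K m := (gauge_pos habs
      (NormedSpace.isVonNBounded_of_isBounded ℝ hK.isCompact.isBounded)).mpr hm
    set q := (gauge K m)⁻¹ • m with hq
    have hqf : q ∈ frontier K := by
      rw [← gauge_eq_one_iff_mem_frontier hK.strictConvex.convex hK.mem_nhds_zero, hq,
        gauge_smul_of_nonneg (by positivity), smul_eq_mul, inv_mul_cancel₀ hg.ne']
    obtain ⟨_, _, U, N, _, hqU, _, hN, _⟩ := hK.curvature_pos q hqf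
    have hu := hN q ⟨hqf, hqU⟩
    set u := N q
    have hu0 := hu.ne_zero
    have hhu := hK.support_pos hu0
    have hX : gradient (supportFunction K) u = q :=
      gradient_supportFunction_eq hK.isCompact hK.strictConvex hu0 hu.1 (hu.inner_eq hK.isCompact)
    -- The multiple of the normal `u` is scaled so that its support value is the gauge of `m`.
    have hc : 0 < gauge K m / supportFunction K u := by positivity
    refine ⟨(gauge K m / supportFunction K u) • u, smul_ne_zero hc.ne' hu0, ?_⟩
    rw [dualityMap, hK.gradient_smul hu0 hc, hX, hK.support_smul hc.le, hq, smul_smul]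
    convert one_smul ℝ m
    field_simp

theorem inner_dualityMap_self (y : EuclideanSpace ℝ (Fin (n + 1))) :
    inner ℝ (dualityMap K y) y = 2 * halfSqSupport K y := by
  rcases eq_or_ne y 0 with rfl | hy
  · simp [hK.halfSqSupport_zero]
  · rw [dualityMap, real_inner_smul_left, hK.inner_gradient hy, halfSqSupport]
    ring

/-- The Fenchel--Young inequality. -/
theorem inner_dualityMap_le (y z : EuclideanSpace ℝ (Fin (n + 1))) :
    inner ℝ (dualityMap K y) z ≤ halfSqSupport K y + halfSqSupport K z := by
  rcases eq_or_ne y 0 with rfl | hy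
  · rw [hK.dualityMap_zero, inner_zero_left, hK.halfSqSupport_zero, halfSqSupport]
    positivity
  · rw [dualityMap, real_inner_smul_left, halfSqSupport, halfSqSupport]
    have h1 := inner_le_supportFunction hK.isCompact (hK.gradient_mem hy) z
    have h2 := mul_le_mul_of_nonneg_left h1 (hK.support_pos hy).le
    nlinarith [sq_nonneg (supportFunction K y - supportFunction K z)]

theorem halfSqSupport_add_inner_le (y z : EuclideanSpace ℝ (Fin (n + 1))) :
    halfSqSupport K y + inner ℝ (dualityMap K y) (z - y) ≤ halfSqSupport K z := by
  have h1 := hK.inner_dualityMap_le y z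
  rw [inner_sub_right, hK.inner_dualityMap_self]
  linarith

/-- Off the origin the differential is bounded, so the mean value inequality handles segments
avoiding 0. On a segment through 0 one has `‖y‖ + ‖z‖ = ‖y - z‖`, and linear growth of `T` suffices.
-/
theorem exists_lipschitz_dualityMap :
    ∃ C : ℝ, 0 ≤ C ∧ ∀ y z, ‖dualityMap K y - dualityMap K z‖ ≤ C * ‖y - z‖ := by
  obtain ⟨C₁, hC₁, h₁⟩ := hK.exists_dualityMap_bound
  obtain ⟨C₂, hC₂, h₂⟩ := hK.exists_dualityHessian_bound
  refine ⟨max C₁ C₂, le_max_of_le_left hC₁, fun y z => ?_⟩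
  by_cases h0 : (0 : EuclideanSpace ℝ (Fin (n + 1))) ∈ segment ℝ z y
  · have hd : ‖y‖ + ‖z‖ = ‖y - z‖ := by
      have := dist_add_dist_of_mem_segment h0
      rw [dist_zero_right, dist_zero_left, dist_eq_norm, norm_sub_rev z y] at this
      linarith
    calc ‖dualityMap K y - dualityMap K z‖ ≤ ‖dualityMap K y‖ + ‖dualityMap K z‖ := norm_sub_le _ _
      _ ≤ C₁ * ‖y‖ + C₁ * ‖z‖ := add_le_add (h₁ y) (h₁ z)
      _ = C₁ * ‖y - z‖ := by rw [← hd]; ring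
      _ ≤ _ := by gcongr; exact le_max_left _ _
  · have hne : ∀ x ∈ segment ℝ z y, x ≠ 0 := fun x hx hx0 => h0 (hx0 ▸ hx)
    have := (convex_segment z y).norm_image_sub_le_of_norm_hasFDerivWithin_le
      (f := dualityMap K) (f' := dualityHessian K) (C := C₂)
      (fun x hx => (hK.hasFDerivAt_dualityMap (hne x hx)).hasFDerivWithinAt)
      (fun x hx => h₂ x (hne x hx)) (left_mem_segment ℝ z y) (right_mem_segment ℝ z y)
    refine this.trans ?_
    gcongr
    exact le_max_right _ _

theorem secondDiff_nonneg (y e : EuclideanSpace ℝ (Fin (n + 1))) :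
    0 ≤ halfSqSupport K (y + e) + halfSqSupport K (y - e) - 2 * halfSqSupport K y := by
  have h1 := hK.halfSqSupport_add_inner_le y (y + e)
  have h2 := hK.halfSqSupport_add_inner_le y (y - e)
  rw [show y + e - y = e by abel] at h1
  rw [show y - e - y = -e by abel, inner_neg_right] at h2
  linarith

theorem exists_secondDiff_le : ∃ C : ℝ, 0 ≤ C ∧ ∀ y e,
    halfSqSupport K (y + e) + halfSqSupport K (y - e) - 2 * halfSqSupport K y ≤ C * ‖e‖ ^ 2 := by
  obtain ⟨C, hC, h⟩ := hK.exists_lipschitz_dualityMap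
  refine ⟨2 * C, by positivity, fun y e => ?_⟩
  have h1 := hK.halfSqSupport_add_inner_le (y + e) y
  have h2 := hK.halfSqSupport_add_inner_le (y - e) y
  rw [show y - (y + e) = -e by abel, inner_neg_right] at h1
  rw [show y - (y - e) = e by abel] at h2
  have h3 := (real_inner_le_norm (dualityMap K (y + e) - dualityMap K (y - e)) e).trans
    (mul_le_mul_of_nonneg_right (h _ _) (norm_nonneg _))
  rw [show y + e - (y - e) = (2 : ℝ) • e by rw [two_smul]; abel, norm_smul, Real.norm_eq_abs,
    abs_two, inner_sub_left] at h3
  nlinarith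

/-- One application of L'Hôpital's rule reduces this to a difference quotient of `T`, which is
differentiable at `y`. -/
theorem tendsto_secondDiff (hy : y ≠ 0) (e : EuclideanSpace ℝ (Fin (n + 1))) :
    Tendsto (fun t : ℝ => (halfSqSupport K (y + t • e) + halfSqSupport K (y - t • e)
      - 2 * halfSqSupport K y) / t ^ 2) (𝓝[>] 0) (𝓝 (inner ℝ (dualityHessian K y e) e)) := by
  have hline : ∀ t : ℝ, HasDerivAt (fun t : ℝ => y + t • e) e t := fun t => by
    simpa using ((hasDerivAt_id t).smul_const e).const_add y
  have hline' : ∀ t : ℝ, HasDerivAt (fun t : ℝ => y - t • e) (-e) t := fun t => by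
    simpa using ((hasDerivAt_id t).smul_const e).const_sub y
  have hev : ∀ᶠ t : ℝ in 𝓝 0, y + t • e ≠ 0 := by
    have : Tendsto (fun t : ℝ => y + t • e) (𝓝 0) (𝓝 y) := by
      simpa using (hline 0).continuousAt.tendsto
    exact this.eventually (isOpen_ne.mem_nhds hy)
  have hev' : ∀ᶠ t : ℝ in 𝓝 0, y - t • e ≠ 0 := by
    have : Tendsto (fun t : ℝ => y - t • e) (𝓝 0) (𝓝 y) := by
      simpa using (hline' 0).continuousAt.tendsto
    exact this.eventually (isOpen_ne.mem_nhds hy)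
  set g' : ℝ → ℝ := fun t => inner ℝ (dualityMap K (y + t • e)) e
    - inner ℝ (dualityMap K (y - t • e)) e with hg'
  have hg : ∀ᶠ t : ℝ in 𝓝[>] 0, HasDerivAt (fun t : ℝ => halfSqSupport K (y + t • e) +
      halfSqSupport K (y - t • e) - 2 * halfSqSupport K y) (g' t) t := by
    filter_upwards [nhdsWithin_le_nhds hev, nhdsWithin_le_nhds hev'] with t ht ht'
    have h1 := (hK.hasFDerivAt_halfSqSupport ht).comp_hasDerivAt t (hline t)
    have h2 := (hK.hasFDerivAt_halfSqSupport ht').comp_hasDerivAt t (hline' t)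
    convert! (h1.add h2).sub_const (2 * halfSqSupport K y) using 1
    simp [hg', sub_eq_add_neg]
  have hd : HasDerivAt g' (2 * inner ℝ (dualityHessian K y e) e) 0 := by
    have e1 : HasFDerivAt (dualityMap K) (dualityHessian K y) (y + (0 : ℝ) • e) := by
      simpa using hK.hasFDerivAt_dualityMap hy
    have e2 : HasFDerivAt (dualityMap K) (dualityHessian K y) (y - (0 : ℝ) • e) := by
      simpa using hK.hasFDerivAt_dualityMap hy
    have h1 := ((e1.comp_hasDerivAt 0 (hline 0)).inner ℝ (hasDerivAt_const (0 : ℝ) e)).sub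
      ((e2.comp_hasDerivAt 0 (hline' 0)).inner ℝ (hasDerivAt_const (0 : ℝ) e))
    convert! h1 using 1
    simp
    ring
  refine HasDerivAt.lhopital_zero_nhdsGT (g' := fun t : ℝ => 2 * t) hg ?_ ?_ ?_ ?_ ?_
  · exact Eventually.of_forall fun t => by simpa using hasDerivAt_pow 2 t
  · filter_upwards [self_mem_nhdsWithin] with t ht
    have : (0 : ℝ) < t := ht
    positivity
  · have hc := hK.continuous_halfSqSupport
    have : Continuous (fun t : ℝ => halfSqSupport K (y + t • e) + halfSqSupport K (y - t • e)
        - 2 * halfSqSupport K y) := by fun_prop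
    have h0 := (this.tendsto 0).mono_left (nhdsWithin_le_nhds (s := Ioi (0 : ℝ)))
    convert h0 using 2
    simp
    ring
  · have : Continuous (fun t : ℝ => t ^ 2) := by fun_prop
    have h0 := (this.tendsto 0).mono_left (nhdsWithin_le_nhds (s := Ioi (0 : ℝ)))
    simpa using h0
  · have h1 := hd.tendsto_slope_zero_right.const_mul (2⁻¹ : ℝ)
    have h2 : g' 0 = 0 := by simp [hg']
    simp only [zero_add, h2, sub_zero, smul_eq_mul] at h1
    convert h1 using 2
    · rw [div_eq_mul_inv, mul_inv]
      ring
    · ring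

end IsSmoothStrictlyConvexBody

end DualityMapGlobal

/-! ### Gaussian integrability, change of variables by `T`, Prékopa–Leindler in the dual variable.
-/

section BrascampLieb

open Filter Topology

variable {n : ℕ}

theorem integrable_exp_neg_mul_sq_norm {c : ℝ} (hc : 0 < c) :
    Integrable fun y : EuclideanSpace ℝ (Fin (n + 1)) => Real.exp (-c * ‖y‖ ^ 2) := by
  have h := (GaussianFourier.integrable_cexp_neg_mul_sq_norm_add (V := EuclideanSpace ℝ (Fin (n + 1)))
    (b := (c : ℂ)) (by simpa using hc) 0 0).re
  refine h.congr (Eventually.of_forall fun y => ?_)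
  have : (-(c : ℂ) * (‖y‖ : ℂ) ^ 2 + 0 * ((inner ℝ 0 y : ℝ) : ℂ))
      = ((-c * ‖y‖ ^ 2 : ℝ) : ℂ) := by
    push_cast
    ring
  simp only [this]
  exact Complex.exp_ofReal_re _

theorem restrict_compl_zero :
    (volume : Measure (EuclideanSpace ℝ (Fin (n + 1)))).restrict {0}ᶜ = volume :=
  Measure.restrict_eq_self_of_ae_mem (by simp [ae_iff])

/-- A function which is continuous off the origin and dominated by a polynomial times a Gaussian is
integrable. -/
theorem integrable_of_gaussian_bound {f : EuclideanSpace ℝ (Fin (n + 1)) → ℝ}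
    (hf : ContinuousOn f {0}ᶜ) {c C : ℝ} (hc : 0 < c)
    (hb : ∀ y, y ≠ 0 → |f y| ≤ C * (1 + ‖y‖ ^ 2) ^ 2 * Real.exp (-c * ‖y‖ ^ 2)) :
    Integrable f := by
  have hmeas : AEStronglyMeasurable f volume := by
    rw [← restrict_compl_zero]
    exact hf.aestronglyMeasurable (measurableSet_singleton 0).compl
  have hint := (integrable_exp_neg_mul_sq_norm (n := n) (half_pos hc)).const_mul
    (|C| * (1 + 4 / c) ^ 2)
  refine hint.mono' hmeas ?_
  have h0 : ∀ᵐ y : EuclideanSpace ℝ (Fin (n + 1)), y ≠ 0 := by simp [ae_iff]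
  filter_upwards [h0] with y hy
  set p := ‖y‖ ^ 2 with hp
  have hp0 : 0 ≤ p := by positivity
  -- Once squared, this absorbs the polynomial at the cost of half of the Gaussian decay.
  have h1 : 1 + p ≤ (1 + 4 / c) * Real.exp (c / 4 * p) := by
    have h2 : 1 + c / 4 * p ≤ Real.exp (c / 4 * p) := by
      linarith [Real.add_one_le_exp (c / 4 * p)]
    have h3 : (1 + 4 / c) * (1 + c / 4 * p) = 1 + p + (4 / c + c / 4 * p) := by
      field_simp
      ring
    calc 1 + p ≤ (1 + 4 / c) * (1 + c / 4 * p) := by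
          rw [h3]
          have : 0 ≤ 4 / c + c / 4 * p := by positivity
          linarith
      _ ≤ _ := by gcongr
  rw [Real.norm_eq_abs]
  calc |f y| ≤ C * (1 + p) ^ 2 * Real.exp (-c * p) := hb y hy
    _ ≤ |C| * ((1 + 4 / c) * Real.exp (c / 4 * p)) ^ 2 * Real.exp (-c * p) := by
        gcongr
        exact le_abs_self C
    _ = _ := by
        rw [mul_pow, ← Real.exp_nat_mul, mul_assoc, mul_assoc, mul_assoc, ← Real.exp_add]
        congr 3
        push_cast
        ring_nf

namespace IsSmoothStrictlyConvexBody

variable {K : Set (EuclideanSpace ℝ (Fin (n + 1)))} (hK : IsSmoothStrictlyConvexBody K)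
include hK

theorem integrable_exp_mul {f : EuclideanSpace ℝ (Fin (n + 1)) → ℝ}
    (hf : ContinuousOn f {0}ᶜ) {C a : ℝ} (ha : 0 < a)
    (hb : ∀ y, y ≠ 0 → |f y| ≤ C * (1 + ‖y‖ ^ 2) ^ 2) :
    Integrable fun y => Real.exp (-a * halfSqSupport K y) * f y := by
  obtain ⟨c, hc, h⟩ := hK.exists_lower_bound_halfSqSupport
  refine integrable_of_gaussian_bound (c := a * c) (C := C) ?_ (by positivity) fun y hy => ?_
  · have := hK.continuous_halfSqSupport
    exact ContinuousOn.mul (by fun_prop) hf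
  · rw [abs_mul, abs_of_pos (Real.exp_pos _), mul_comm]
    refine mul_le_mul (hb y hy) (Real.exp_le_exp.mpr ?_) (Real.exp_pos _).le
      ((abs_nonneg _).trans (hb y hy))
    nlinarith [h y]

theorem lintegral_eq_lintegral_dualityMap (u : EuclideanSpace ℝ (Fin (n + 1)) → ENNReal) :
    ∫⁻ x, u x = ∫⁻ y, ENNReal.ofReal |(dualityHessian K y).det| * u (dualityMap K y) := by
  have := lintegral_image_eq_lintegral_abs_det_fderiv_mul volume
    (measurableSet_singleton (0 : EuclideanSpace ℝ (Fin (n + 1)))).compl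
    (fun y hy => (hK.hasFDerivAt_dualityMap hy).hasFDerivWithinAt) hK.injOn_dualityMap u
  rwa [hK.image_dualityMap, restrict_compl_zero] at this

theorem integral_eq_integral_dualityMap (f : EuclideanSpace ℝ (Fin (n + 1)) → ℝ) :
    ∫ x, f x = ∫ y, |(dualityHessian K y).det| * f (dualityMap K y) := by
  have := integral_image_eq_integral_abs_det_fderiv_smul volume
    (measurableSet_singleton (0 : EuclideanSpace ℝ (Fin (n + 1)))).compl
    (fun y hy => (hK.hasFDerivAt_dualityMap hy).hasFDerivWithinAt) hK.injOn_dualityMap f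
  rwa [hK.image_dualityMap, restrict_compl_zero] at this

/-- The Prékopa--Leindler inequality for the measure with potential the Legendre transform of
`halfSqSupport K`, written in the dual coordinate. -/
theorem prekopa_leindler_dual (e : EuclideanSpace ℝ (Fin (n + 1))) :
    (∫⁻ y, ENNReal.ofReal |(dualityHessian K y).det| *
        ENNReal.ofReal (Real.exp (-halfSqSupport K y + inner ℝ (dualityMap K y) e))) *
      (∫⁻ y, ENNReal.ofReal |(dualityHessian K y).det| *
        ENNReal.ofReal (Real.exp (-halfSqSupport K y - inner ℝ (dualityMap K y) e))) ≤
    (∫⁻ y, ENNReal.ofReal |(dualityHessian K y).det| *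
        ENNReal.ofReal (Real.exp (-halfSqSupport K y + (halfSqSupport K (y + e) +
          halfSqSupport K (y - e) - 2 * halfSqSupport K y) / 2))) ^ 2 := by
  set S : Set (EuclideanSpace ℝ (Fin (n + 1))) := {0}ᶜ with hS
  set T : S → EuclideanSpace ℝ (Fin (n + 1)) := fun y => dualityMap K y with hT
  have hTe : MeasurableEmbedding T :=
    hK.continuousOn_dualityMap.measurableEmbedding (measurableSet_singleton _).compl
      hK.injOn_dualityMap
  have hH := hK.continuous_halfSqSupport
  have hTc : Continuous T := hK.continuousOn_dualityMap.domRestrict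
  have hne : ∀ y : S, T y ≠ 0 := fun y => hK.dualityMap_ne_zero y.2
  have hsurj : ∀ x, x ≠ 0 → ∃ y, T y = x := by
    intro x hx
    have : x ∈ dualityMap K '' {0}ᶜ := by rw [hK.image_dualityMap]; exact hx
    obtain ⟨y, hy, hyx⟩ := this
    exact ⟨⟨y, hy⟩, hyx⟩
  have hn0 : ¬ ∃ y, T y = 0 := fun ⟨y, hy⟩ => hne y hy
  -- Functions of `y ≠ 0` are transported to `x = T y`, which misses only the origin. The value
  -- there will be 0 for the two left-hand functions and `⊤` for the right-hand one, so the
  -- pointwise hypothesis is trivial at 0.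
  set ext : (EuclideanSpace ℝ (Fin (n + 1)) → ℝ) → ENNReal →
      EuclideanSpace ℝ (Fin (n + 1)) → ENNReal := fun f c =>
    Function.extend T (fun y => ENNReal.ofReal (Real.exp (f y))) (fun _ => c) with hext
  have hextT : ∀ f c (y : S), ext f c (T y) = ENNReal.ofReal (Real.exp (f y)) := fun f c y =>
    hTe.injective.extend_apply _ _ _
  have hext0 : ∀ f c, ext f c 0 = c := fun f c => Function.extend_apply' _ _ _ hn0
  have hextm : ∀ f c, Continuous (fun y : S => f y) → Measurable (ext f c) := fun f c hf =>
    hTe.measurable_extend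
      (ENNReal.measurable_ofReal.comp (Real.measurable_exp.comp hf.measurable)) measurable_const
  have hextI : ∀ f c, ∫⁻ x, ext f c x
      = ∫⁻ y, ENNReal.ofReal |(dualityHessian K y).det| * ENNReal.ofReal (Real.exp (f y)) := by
    intro f c
    rw [hK.lintegral_eq_lintegral_dualityMap]
    refine lintegral_congr_ae ?_
    have h0 : ∀ᵐ y : EuclideanSpace ℝ (Fin (n + 1)), y ≠ 0 := by simp [ae_iff]
    filter_upwards [h0] with y hy
    rw [← hextT f c ⟨y, hy⟩]
  clear_value ext
  have hTc' : Continuous fun y : S => dualityMap K y := hTc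
  rw [← hextI _ 0, ← hextI _ 0, ← hextI (fun y => -halfSqSupport K y + (halfSqSupport K (y + e) +
          halfSqSupport K (y - e) - 2 * halfSqSupport K y) / 2) ⊤]
  refine prekopa_leindler (n + 1) ?_ ?_ ?_ fun x x' => ?_
  · exact hextm _ _ (by fun_prop)
  · exact hextm _ _ (by fun_prop)
  · exact hextm _ _ (by fun_prop)
  · rcases eq_or_ne x 0 with rfl | hx
    · simp [hext0]
    rcases eq_or_ne x' 0 with rfl | hx'
    · simp [hext0]
    obtain ⟨a, rfl⟩ := hsurj x hx
    obtain ⟨b, rfl⟩ := hsurj x' hx'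
    rcases eq_or_ne ((2 : ℝ)⁻¹ • (T a + T b)) 0 with hm | hm
    · simp [hm, hext0]
    obtain ⟨y, hy⟩ := hsurj _ hm
    rw [← hy, hextT, hextT, hextT, ← ENNReal.ofReal_mul (Real.exp_pos _).le,
      ← ENNReal.ofReal_pow (Real.exp_pos _).le, ← Real.exp_add, ← Real.exp_nat_mul]
    refine ENNReal.ofReal_le_ofReal (Real.exp_le_exp.mpr ?_)
    -- With `T y = (T a + T b)/2`, adding Fenchel–Young at `(a, y + e)` and `(b, y - e)` gives the
    -- required comparison of exponents.
    have h1 := hK.inner_dualityMap_le a (y + e)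
    have h2 := hK.inner_dualityMap_le b (y - e)
    have h3 := hK.inner_dualityMap_self y
    have h4 : inner ℝ (dualityMap K y) (y : EuclideanSpace ℝ (Fin (n + 1)))
        = (2 : ℝ)⁻¹ * (inner ℝ (dualityMap K a) (y : EuclideanSpace ℝ (Fin (n + 1)))
          + inner ℝ (dualityMap K b) (y : EuclideanSpace ℝ (Fin (n + 1)))) := by
      rw [← inner_add_left, ← real_inner_smul_left]
      exact congrArg (fun z => inner ℝ z (y : EuclideanSpace ℝ (Fin (n + 1)))) hy
    rw [inner_add_right] at h1
    rw [inner_sub_right] at h2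
    push_cast
    linarith

end IsSmoothStrictlyConvexBody

end BrascampLieb

/-! ### A cubic lower bound for `exp`, and the vanishing mean of `e^{-gauge²/2}`. -/

section BrascampLiebLinear

open Filter Topology

/-- The cubic remainder `g` has derivative the quadratic remainder `f`, which is increasing and
vanishes at 0, so `g` is minimal at 0. The odd order is what allows all real `s`. -/
theorem Real.cubic_taylor_le_exp (s : ℝ) : 1 + s + s ^ 2 / 2 + s ^ 3 / 6 ≤ Real.exp s := by
  set f : ℝ → ℝ := fun s => Real.exp s - (1 + s + s ^ 2 / 2) with hf
  set g : ℝ → ℝ := fun s => Real.exp s - (1 + s + s ^ 2 / 2 + s ^ 3 / 6) with hg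
  have hf' : ∀ s, HasDerivAt f (Real.exp s - (1 + s)) s := fun s => by
    have h := (Real.hasDerivAt_exp s).sub
      (((hasDerivAt_id s).const_add 1).add ((hasDerivAt_pow 2 s).div_const 2))
    convert! h using 1
    simp
  have hg' : ∀ s, HasDerivAt g (f s) s := fun s => by
    have h := (Real.hasDerivAt_exp s).sub
      ((((hasDerivAt_id s).const_add 1).add ((hasDerivAt_pow 2 s).div_const 2)).add
        ((hasDerivAt_pow 3 s).div_const 6))
    convert! h using 1
    simp [hf]
    ring
  have hfm : Monotone f := monotone_of_deriv_nonneg (fun s => (hf' s).differentiableAt) fun s => by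
    rw [(hf' s).deriv]
    linarith [Real.add_one_le_exp s]
  have hf0 : f 0 = 0 := by simp [hf]
  have hg0 : g 0 = 0 := by simp [hg]
  have hgc : Continuous g := continuous_iff_continuousAt.mpr fun s => (hg' s).continuousAt
  have key : 0 ≤ g s := by
    rcases le_total 0 s with hs | hs
    · have : MonotoneOn g (Ici 0) := monotoneOn_of_deriv_nonneg (convex_Ici 0) hgc.continuousOn
        (fun s _ => (hg' s).differentiableAt.differentiableWithinAt) fun s hs => by
          rw [interior_Ici] at hs
          rw [(hg' s).deriv, ← hf0]
          exact hfm (le_of_lt hs)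
      exact hg0 ▸ this self_mem_Ici hs hs
    · have : AntitoneOn g (Iic 0) := antitoneOn_of_deriv_nonpos (convex_Iic 0) hgc.continuousOn
        (fun s _ => (hg' s).differentiableAt.differentiableWithinAt) fun s hs => by
          rw [interior_Iic] at hs
          rw [(hg' s).deriv, ← hf0]
          exact hfm (le_of_lt hs)
      exact hg0 ▸ this hs self_mem_Iic hs
  simp only [hg] at key
  linarith

theorem ofReal_integral_le_lintegral {α : Type*} [MeasurableSpace α] {μ : Measure α} {f g : α → ℝ}
    (hf : Integrable f μ) (hfg : ∀ x, f x ≤ g x) :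
    ENNReal.ofReal (∫ x, f x ∂μ) ≤ ∫⁻ x, ENNReal.ofReal (g x) ∂μ := by
  calc ENNReal.ofReal (∫ x, f x ∂μ) ≤ ENNReal.ofReal (∫ x, max (f x) 0 ∂μ) :=
        ENNReal.ofReal_le_ofReal (integral_mono hf hf.pos_part fun x => le_max_left _ _)
    _ = ∫⁻ x, ENNReal.ofReal (max (f x) 0) ∂μ :=
        ofReal_integral_eq_lintegral_ofReal hf.pos_part
          (Eventually.of_forall fun x => le_max_right _ _)
    _ ≤ _ := lintegral_mono fun x => by
        rw [ENNReal.ofReal_max, ENNReal.ofReal_zero, max_eq_left zero_le]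
        exact ENNReal.ofReal_le_ofReal (hfg x)

theorem integral_Ioi_mul_exp_neg_sq_div_two (a : ℝ) :
    IntegrableOn (fun s : ℝ => s * Real.exp (-(s ^ 2 / 2))) (Ioi 0) ∧
    (0 ≤ a → ∫ s in Ioi a, s * Real.exp (-(s ^ 2 / 2)) = Real.exp (-(a ^ 2 / 2))) := by
  have hderiv : ∀ s : ℝ, HasDerivAt (fun s : ℝ => -Real.exp (-(s ^ 2 / 2)))
      (s * Real.exp (-(s ^ 2 / 2))) s := fun s => by
    have h := (((hasDerivAt_pow 2 s).div_const 2).neg.exp).neg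
    convert! h using 1
    simp
    ring
  have hlim : Tendsto (fun s : ℝ => -Real.exp (-(s ^ 2 / 2))) atTop (𝓝 0) := by
    have h1 : Tendsto (fun s : ℝ => s ^ 2 / 2) atTop atTop :=
      (tendsto_pow_atTop two_ne_zero).atTop_div_const two_pos
    simpa using (Real.tendsto_exp_neg_atTop_nhds_zero.comp h1).neg
  have hint : ∀ b : ℝ, 0 ≤ b → IntegrableOn (fun s : ℝ => s * Real.exp (-(s ^ 2 / 2))) (Ioi b) :=
    fun b hb => integrableOn_Ioi_deriv_of_nonneg' (fun s _ => hderiv s) (fun s hs =>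
      mul_nonneg (hb.trans (le_of_lt hs)) (Real.exp_pos _).le) hlim
  refine ⟨hint 0 le_rfl, fun ha => ?_⟩
  rw [integral_Ioi_of_hasDerivAt_of_tendsto' (fun s _ => hderiv s) (hint a ha) hlim]
  simp

variable {n : ℕ}

namespace IsSmoothStrictlyConvexBody

variable {K : Set (EuclideanSpace ℝ (Fin (n + 1)))} (hK : IsSmoothStrictlyConvexBody K)
include hK

theorem integral_inner_eq_zero (hc : centroidOf K = 0) (e : EuclideanSpace ℝ (Fin (n + 1))) :
    ∫ x in K, inner ℝ x e = 0 := by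
  have hvol : volume.real K ≠ 0 := by
    refine (ENNReal.toReal_pos ?_ hK.isCompact.measure_lt_top.ne).ne'
    exact (Measure.measure_pos_of_mem_nhds volume hK.mem_nhds_zero).ne'
  have h1 : ∫ x in K, x = 0 := by
    rcases smul_eq_zero.mp hc with h | h
    · exact absurd h (inv_ne_zero hvol)
    · exact h
  have hint : IntegrableOn (fun x : EuclideanSpace ℝ (Fin (n + 1)) => x) K :=
    continuous_id.continuousOn.integrableOn_compact hK.isCompact
  have h2 := integral_inner (𝕜 := ℝ) hint e
  rw [h1, inner_zero_right] at h2
  rw [← h2]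
  exact integral_congr_ae (Eventually.of_forall fun x => real_inner_comm _ _)

theorem continuous_gauge : Continuous (gauge K) :=
  _root_.continuous_gauge hK.strictConvex.convex hK.mem_nhds_zero

theorem exists_gauge_lower_bound : ∃ c : ℝ, 0 < c ∧ ∀ x, c * ‖x‖ ^ 2 ≤ gauge K x ^ 2 / 2 := by
  obtain ⟨R, hR, hKR⟩ := hK.isCompact.isBounded.subset_closedBall_lt 0 0
  refine ⟨(R⁻¹) ^ 2 / 2, by positivity, fun x => ?_⟩
  have h1 := le_gauge_of_subset_closedBall (absorbent_nhds_zero hK.mem_nhds_zero) hR.le hKR (x := x)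
  have h2 := pow_le_pow_left₀ (by positivity) h1 2
  rw [div_eq_mul_inv, mul_pow] at h2
  linarith

theorem integrable_exp_gauge :
    Integrable fun x => Real.exp (-(gauge K x ^ 2 / 2)) := by
  obtain ⟨c, hc, h⟩ := hK.exists_gauge_lower_bound
  have := hK.continuous_gauge
  refine integrable_of_gaussian_bound (c := c) (C := 1) (by fun_prop) hc fun x _ => ?_
  rw [abs_of_pos (Real.exp_pos _)]
  calc Real.exp (-(gauge K x ^ 2 / 2)) ≤ Real.exp (-c * ‖x‖ ^ 2) :=
        Real.exp_le_exp.mpr (by linarith [h x])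
    _ = 1 * Real.exp (-c * ‖x‖ ^ 2) := (one_mul _).symm
    _ ≤ _ := by
        gcongr
        nlinarith [sq_nonneg ‖x‖]

theorem integrable_inner_mul_exp_gauge (e : EuclideanSpace ℝ (Fin (n + 1))) :
    Integrable fun x => inner ℝ x e * Real.exp (-(gauge K x ^ 2 / 2)) := by
  obtain ⟨c, hc, h⟩ := hK.exists_gauge_lower_bound
  have := hK.continuous_gauge
  refine integrable_of_gaussian_bound (c := c) (C := ‖e‖) (by fun_prop) hc fun x _ => ?_
  rw [abs_mul, abs_of_pos (Real.exp_pos _)]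
  have h1 : |inner ℝ x e| ≤ ‖e‖ * (1 + ‖x‖ ^ 2) ^ 2 := by
    have h2 : ‖x‖ ≤ (1 + ‖x‖ ^ 2) ^ 2 := by nlinarith [sq_nonneg (‖x‖ - 1), sq_nonneg (‖x‖ ^ 2)]
    calc |inner ℝ x e| ≤ ‖x‖ * ‖e‖ := abs_real_inner_le_norm _ _
      _ ≤ (1 + ‖x‖ ^ 2) ^ 2 * ‖e‖ := by gcongr
      _ = _ := mul_comm _ _
  gcongr
  linarith [h x]

/-- Since `e^{-g²/2} = ∫_g^∞ s e^{-s²/2} ds`, the density is a mixture of indicators of the dilates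
`sK`, each with centroid 0. -/
theorem integral_inner_mul_exp_gauge (hc : centroidOf K = 0)
    (e : EuclideanSpace ℝ (Fin (n + 1))) :
    ∫ x, inner ℝ x e * Real.exp (-(gauge K x ^ 2 / 2)) = 0 := by
  have hg := hK.continuous_gauge
  set k : ℝ → ℝ := fun s => s * Real.exp (-(s ^ 2 / 2)) with hk
  have hkc : Continuous k := by fun_prop
  set F : EuclideanSpace ℝ (Fin (n + 1)) → ℝ → ℝ := fun x s =>
    inner ℝ x e * (Ici (gauge K x)).indicator k s with hF
  have hsub : ∀ x, Ioi (gauge K x) ⊆ Ioi 0 := fun x => Ioi_subset_Ioi (gauge_nonneg x)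
  have hinner : ∀ x, ∫ s in Ioi 0, (Ici (gauge K x)).indicator k s
      = Real.exp (-(gauge K x ^ 2 / 2)) := by
    intro x
    have h1 : ∫ s in Ioi 0, (Ici (gauge K x)).indicator k s
        = ∫ s in Ioi 0, (Ioi (gauge K x)).indicator k s := by
      refine integral_congr_ae ?_
      refine ae_restrict_of_ae ?_
      exact indicator_ae_eq_of_ae_eq_set Ioi_ae_eq_Ici.symm
    rw [h1, setIntegral_indicator measurableSet_Ioi, inter_eq_right.mpr (hsub x)]
    exact (integral_Ioi_mul_exp_neg_sq_div_two _).2 (gauge_nonneg x)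
  have hkint : ∀ x, Integrable ((Ici (gauge K x)).indicator k) (volume.restrict (Ioi 0)) :=
    fun x => (integral_Ioi_mul_exp_neg_sq_div_two 0).1.indicator measurableSet_Ici
  have hset : MeasurableSet {p : EuclideanSpace ℝ (Fin (n + 1)) × ℝ | gauge K p.1 ≤ p.2} :=
    (isClosed_le (hg.comp continuous_fst) continuous_snd).measurableSet
  have hFm : Measurable (Function.uncurry F) := by
    have : Function.uncurry F = fun p => inner ℝ p.1 e *
        {p : EuclideanSpace ℝ (Fin (n + 1)) × ℝ | gauge K p.1 ≤ p.2}.indicator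
          (fun p => k p.2) p := by
      ext p
      rfl
    rw [this]
    have hm1 : Measurable fun p : EuclideanSpace ℝ (Fin (n + 1)) × ℝ => k p.2 :=
      hkc.measurable.comp measurable_snd
    have hc1 : Continuous fun p : EuclideanSpace ℝ (Fin (n + 1)) × ℝ => inner ℝ p.1 e := by fun_prop
    exact hc1.measurable.mul (hm1.indicator hset)
  have hFint : Integrable (Function.uncurry F) (volume.prod (volume.restrict (Ioi 0))) := by
    rw [integrable_prod_iff hFm.aestronglyMeasurable]
    refine ⟨Eventually.of_forall fun x => (hkint x).const_mul (inner ℝ x e), ?_⟩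
    refine (hK.integrable_inner_mul_exp_gauge e).norm.congr (Eventually.of_forall fun x => ?_)
    have h2 : ∀ s ∈ Ioi (0 : ℝ), ‖Function.uncurry F (x, s)‖
        = |inner ℝ x e| * (Ici (gauge K x)).indicator k s := by
      intro s hs
      have : 0 ≤ (Ici (gauge K x)).indicator k s := by
        rw [indicator_apply]
        split_ifs
        · exact mul_nonneg (le_of_lt hs) (Real.exp_pos _).le
        · exact le_rfl
      simp [F, abs_of_nonneg this]
    simp only
    rw [setIntegral_congr_fun measurableSet_Ioi h2, integral_const_mul, hinner, norm_mul,
      Real.norm_eq_abs, Real.norm_of_nonneg (Real.exp_pos _).le]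
  calc ∫ x, inner ℝ x e * Real.exp (-(gauge K x ^ 2 / 2))
      = ∫ x, ∫ s in Ioi 0, F x s := by
        refine integral_congr_ae (Eventually.of_forall fun x => ?_)
        simp only [hF, integral_const_mul, hinner]
    _ = ∫ s in Ioi 0, ∫ x, F x s := integral_integral_swap hFint
    _ = ∫ s in Ioi (0 : ℝ), 0 := by
        refine setIntegral_congr_fun measurableSet_Ioi fun s hs => ?_
        have hs : 0 < s := hs
        have h3 : ∀ z, F (s • z) s = s * k s * K.indicator (fun z => inner ℝ z e) z := by
          intro z
          simp only [hF, gauge_smul_of_nonneg hs.le, real_inner_smul_left]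
          by_cases hz : z ∈ K
          · have : gauge K z ≤ 1 := gauge_le_one_of_mem hz
            rw [indicator_of_mem hz, indicator_of_mem]
            · ring
            · simp only [smul_eq_mul, mem_Ici]
              nlinarith
          · have : 1 < gauge K z := by
              by_contra hcon
              have := (gauge_le_one_iff_mem_closure hK.strictConvex.convex hK.mem_nhds_zero).mp
                (not_lt.mp hcon)
              rw [hK.isCompact.isClosed.closure_eq] at this
              exact hz this
            rw [indicator_of_notMem hz, indicator_of_notMem]
            · ring
            · simp only [smul_eq_mul, mem_Ici, not_le]
              nlinarith
        have h4 := Measure.integral_comp_smul volume (fun x => F x s) s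
        simp only [h3] at h4
        rw [integral_const_mul, integral_indicator hK.isCompact.measurableSet,
          hK.integral_inner_eq_zero hc, mul_zero, eq_comm, smul_eq_zero] at h4
        rcases h4 with h4 | h4
        · exact absurd h4 (by positivity)
        · exact h4
    _ = 0 := by simp

theorem exp_gauge_dualityMap (y : EuclideanSpace ℝ (Fin (n + 1))) :
    Real.exp (-(gauge K (dualityMap K y) ^ 2 / 2)) = Real.exp (-halfSqSupport K y) := by
  rw [hK.gauge_dualityMap, halfSqSupport]

theorem integral_det_mul_exp_pos :
    0 < ∫ y, Real.exp (-halfSqSupport K y) * |(dualityHessian K y).det| := by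
  have h := hK.integral_eq_integral_dualityMap fun x => Real.exp (-(gauge K x ^ 2 / 2))
  simp only [hK.exp_gauge_dualityMap] at h
  simp only [mul_comm (Real.exp _)]
  rw [← h]
  exact integral_exp_pos hK.integrable_exp_gauge

theorem integral_inner_dualityMap (hc : centroidOf K = 0)
    (e : EuclideanSpace ℝ (Fin (n + 1))) :
    ∫ y, Real.exp (-halfSqSupport K y) *
      (|(dualityHessian K y).det| * inner ℝ (dualityMap K y) e) = 0 := by
  have h := hK.integral_eq_integral_dualityMap fun x =>
    inner ℝ x e * Real.exp (-(gauge K x ^ 2 / 2))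
  simp only [hK.exp_gauge_dualityMap] at h
  rw [hK.integral_inner_mul_exp_gauge hc] at h
  rw [h]
  exact integral_congr_ae (Eventually.of_forall fun x => by ring)

end IsSmoothStrictlyConvexBody

end BrascampLiebLinear

/-! ### The Brascamp–Lieb inequality for linear functions. -/

section BrascampLiebMain

open Filter Topology

theorem integral_add_add_add {α : Type*} [MeasurableSpace α] {μ : Measure α}
    {f₁ f₂ f₃ f₄ : α → ℝ} (h₁ : Integrable f₁ μ) (h₂ : Integrable f₂ μ) (h₃ : Integrable f₃ μ)
    (h₄ : Integrable f₄ μ) :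
    ∫ x, (f₁ x + f₂ x + f₃ x + f₄ x) ∂μ
      = ∫ x, f₁ x ∂μ + ∫ x, f₂ x ∂μ + ∫ x, f₃ x ∂μ + ∫ x, f₄ x ∂μ := by
  rw [integral_add (f := fun x => f₁ x + f₂ x + f₃ x) ((h₁.add h₂).add h₃) h₄,
    integral_add (f := fun x => f₁ x + f₂ x) (h₁.add h₂) h₃, integral_add h₁ h₂]

variable {n : ℕ}

namespace IsSmoothStrictlyConvexBody

variable {K : Set (EuclideanSpace ℝ (Fin (n + 1)))} (hK : IsSmoothStrictlyConvexBody K)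
include hK

theorem integrable_exp_mul_det_mul {f : EuclideanSpace ℝ (Fin (n + 1)) → ℝ}
    (hf : ContinuousOn f {0}ᶜ) {C a : ℝ} (ha : 0 < a)
    (hb : ∀ y, y ≠ 0 → |f y| ≤ C * (1 + ‖y‖ ^ 2) ^ 2) :
    Integrable fun y => Real.exp (-a * halfSqSupport K y) * (|(dualityHessian K y).det| * f y) := by
  obtain ⟨D, hD, h⟩ := hK.exists_det_bound
  refine hK.integrable_exp_mul (C := D * C) (hK.continuousOn_det_dualityHessian.mul hf) ha
    fun y hy => ?_
  rw [Pi.mul_apply, abs_mul, abs_abs, mul_assoc]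
  exact mul_le_mul (h y hy) (hb y hy) (abs_nonneg _) hD

theorem integrable_exp_mul_det_mul_inner_pow (e : EuclideanSpace ℝ (Fin (n + 1))) {k : ℕ}
    (hk : k ≤ 4) :
    Integrable fun y => Real.exp (-halfSqSupport K y) *
      (|(dualityHessian K y).det| * inner ℝ (dualityMap K y) e ^ k) := by
  obtain ⟨C, hC, h⟩ := hK.exists_dualityMap_bound
  have := hK.integrable_exp_mul_det_mul (f := fun y => inner ℝ (dualityMap K y) e ^ k)
    (C := (C * ‖e‖) ^ k) (a := 1) ((hK.continuousOn_dualityMap.inner continuousOn_const).pow k)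
    one_pos fun y hy => ?_
  · simpa using this
  · have h1 : |inner ℝ (dualityMap K y) e| ≤ C * ‖e‖ * ‖y‖ :=
      (abs_real_inner_le_norm _ _).trans (by
        calc _ ≤ C * ‖y‖ * ‖e‖ := by gcongr; exact h y
          _ = _ := by ring)
    have h2 : ‖y‖ ^ k ≤ (1 + ‖y‖ ^ 2) ^ 2 := by
      have hy0 := norm_nonneg y
      interval_cases k <;> nlinarith [sq_nonneg (‖y‖ ^ 2), sq_nonneg (‖y‖ - 1),
        mul_nonneg hy0 (sq_nonneg (‖y‖ - 1))]
    rw [abs_pow]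
    calc |inner ℝ (dualityMap K y) e| ^ k ≤ (C * ‖e‖ * ‖y‖) ^ k := by gcongr
      _ = (C * ‖e‖) ^ k * ‖y‖ ^ k := mul_pow _ _ _
      _ ≤ _ := by gcongr

/-- The Brascamp--Lieb inequality for linear functions. -/
theorem integral_inner_sq_le (hc : centroidOf K = 0) (e : EuclideanSpace ℝ (Fin (n + 1))) :
    ∫ y, Real.exp (-halfSqSupport K y) *
      (|(dualityHessian K y).det| * inner ℝ (dualityMap K y) e ^ 2) ≤
    ∫ y, Real.exp (-halfSqSupport K y) *
      (|(dualityHessian K y).det| * inner ℝ (dualityHessian K y e) e) := by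
  set H := halfSqSupport K with hH
  set D : EuclideanSpace ℝ (Fin (n + 1)) → ℝ := fun y => |(dualityHessian K y).det| with hD
  set τ : EuclideanSpace ℝ (Fin (n + 1)) → ℝ := fun y => inner ℝ (dualityMap K y) e with hτ
  set q : EuclideanSpace ℝ (Fin (n + 1)) → ℝ := fun y => inner ℝ (dualityHessian K y e) e with hq
  set δ : ℝ → EuclideanSpace ℝ (Fin (n + 1)) → ℝ := fun t y =>
    H (y + t • e) + H (y - t • e) - 2 * H y with hδ
  set Z := ∫ y, Real.exp (-H y) * D y with hZ
  set Q := ∫ y, Real.exp (-H y) * (D y * τ y ^ 2) with hQ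
  set R := ∫ y, Real.exp (-H y) * (D y * τ y ^ 3) with hR
  set L := ∫ y, Real.exp (-H y) * (D y * q y) with hL
  have hD0 : ∀ y, 0 ≤ D y := fun y => abs_nonneg _
  have hHc : Continuous H := hK.continuous_halfSqSupport
  have hi0 : Integrable fun y => Real.exp (-H y) * D y := by
    simpa using hK.integrable_exp_mul_det_mul_inner_pow e (k := 0) (by norm_num)
  have hi1 : Integrable fun y => Real.exp (-H y) * (D y * τ y) := by
    simpa using hK.integrable_exp_mul_det_mul_inner_pow e (k := 1) (by norm_num)
  have hi2 : Integrable fun y => Real.exp (-H y) * (D y * τ y ^ 2) :=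
    hK.integrable_exp_mul_det_mul_inner_pow e (k := 2) (by norm_num)
  have hi3 : Integrable fun y => Real.exp (-H y) * (D y * τ y ^ 3) :=
    hK.integrable_exp_mul_det_mul_inner_pow e (k := 3) (by norm_num)
  have hM : ∫ y, Real.exp (-H y) * (D y * τ y) = 0 := hK.integral_inner_dualityMap hc e
  have hZ0 : 0 < Z := hK.integral_det_mul_exp_pos
  -- The linear term of the expansion vanishes by `hM`, that is, by the centring of `K`.
  have hlower : ∀ t : ℝ, ENNReal.ofReal (Z + t ^ 2 * Q / 2 + t ^ 3 * R / 6) ≤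
      ∫⁻ y, ENNReal.ofReal (D y) * ENNReal.ofReal (Real.exp (-H y + t * τ y)) := by
    intro t
    have hint : Integrable fun y => Real.exp (-H y) * D y + t * (Real.exp (-H y) * (D y * τ y))
        + t ^ 2 / 2 * (Real.exp (-H y) * (D y * τ y ^ 2))
        + t ^ 3 / 6 * (Real.exp (-H y) * (D y * τ y ^ 3)) :=
      ((hi0.add (hi1.const_mul t)).add (hi2.const_mul (t ^ 2 / 2))).add (hi3.const_mul (t ^ 3 / 6))
    have hval : ∫ y, (Real.exp (-H y) * D y + t * (Real.exp (-H y) * (D y * τ y))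
        + t ^ 2 / 2 * (Real.exp (-H y) * (D y * τ y ^ 2))
        + t ^ 3 / 6 * (Real.exp (-H y) * (D y * τ y ^ 3)))
        = Z + t ^ 2 * Q / 2 + t ^ 3 * R / 6 := by
      rw [integral_add_add_add hi0 (hi1.const_mul t) (hi2.const_mul (t ^ 2 / 2))
          (hi3.const_mul (t ^ 3 / 6)), integral_const_mul, integral_const_mul,
        integral_const_mul, hM]
      ring
    rw [← hval]
    simp_rw [← ENNReal.ofReal_mul (hD0 _)]
    refine ofReal_integral_le_lintegral hint fun y => ?_
    rw [Real.exp_add]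
    have h1 := Real.cubic_taylor_le_exp (t * τ y)
    have h2 := mul_le_mul_of_nonneg_left h1 (mul_nonneg (hD0 y) (Real.exp_pos (-H y)).le)
    calc _ = D y * Real.exp (-H y) * (1 + t * τ y + (t * τ y) ^ 2 / 2 + (t * τ y) ^ 3 / 6) := by ring
      _ ≤ _ := h2
      _ = _ := by ring
  obtain ⟨M, hM0, hδM⟩ : ∃ M : ℝ, 0 ≤ M ∧ ∀ t y, δ t y ≤ t ^ 2 * M := by
    obtain ⟨C, hC, h⟩ := hK.exists_secondDiff_le
    refine ⟨C * ‖e‖ ^ 2, by positivity, fun t y => ?_⟩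
    have := h y (t • e)
    rw [norm_smul, mul_pow, Real.norm_eq_abs, sq_abs] at this
    linarith
  have hδ0 : ∀ t y, 0 ≤ δ t y := fun t y => hK.secondDiff_nonneg y (t • e)
  have hδc : ∀ t, Continuous (δ t) := fun t => by fun_prop
  have hgm : ∀ t : ℝ, AEStronglyMeasurable
      (fun y => Real.exp (-H y) * D y * Real.exp (δ t y / 2)) volume := fun t =>
    hi0.aestronglyMeasurable.mul (by have := hδc t; fun_prop)
  have hgi : ∀ t : ℝ, Integrable fun y => Real.exp (-H y) * D y * Real.exp (δ t y / 2) := by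
    intro t
    refine (hi0.mul_const (Real.exp (t ^ 2 * M / 2))).mono' (hgm t)
      (Eventually.of_forall fun y => ?_)
    rw [Real.norm_of_nonneg (by have := hD0 y; positivity)]
    have := hD0 y
    gcongr
    exact hδM t y
  set b : ℝ → ℝ := fun t => ∫ y, Real.exp (-H y) * D y * Real.exp (δ t y / 2) with hb
  have hb0 : ∀ t, 0 ≤ b t := fun t => integral_nonneg fun y => by
    have := hD0 y
    positivity
  have hupper : ∀ t, ∫⁻ y, ENNReal.ofReal (D y) * ENNReal.ofReal (Real.exp (-H y + δ t y / 2))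
      = ENNReal.ofReal (b t) := by
    intro t
    rw [hb, ofReal_integral_eq_lintegral_ofReal (hgi t) (Eventually.of_forall fun y => by
      have := hD0 y
      positivity)]
    refine lintegral_congr fun y => ?_
    rw [← ENNReal.ofReal_mul (hD0 y), Real.exp_add]
    congr 1
    ring
  -- Prékopa–Leindler with shift `t e`; the second factor is the lower bound at `-t`. Nonnegativity
  -- of one factor is enough to multiply under `ENNReal.ofReal`.
  have hPL : ∀ t, 0 ≤ Z + t ^ 2 * Q / 2 + t ^ 3 * R / 6 →
      (Z + t ^ 2 * Q / 2 + t ^ 3 * R / 6) * (Z + t ^ 2 * Q / 2 - t ^ 3 * R / 6) ≤ b t ^ 2 := by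
    intro t ht
    have h1 := hK.prekopa_leindler_dual (t • e)
    simp only [real_inner_smul_right] at h1
    have h2 := hlower (-t)
    simp only [neg_mul, ← sub_eq_add_neg] at h2
    have h3 := (mul_le_mul' (hlower t) h2).trans (h1.trans_eq (congrArg (· ^ 2) (hupper t)))
    rw [← ENNReal.ofReal_mul ht, ← ENNReal.ofReal_pow (hb0 t),
      ENNReal.ofReal_le_ofReal_iff (by positivity)] at h3
    calc _ = _ := by ring
      _ ≤ _ := h3
  -- Thus `b t = Z + t² L / 2 + o(t²)`. Dominated convergence uses `s ≤ e^s - 1 ≤ s e^s` for `s =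
  -- δ/2`, together with `0 ≤ δ ≤ t² M`.
  have hlim : Tendsto (fun t => (b t - Z) / t ^ 2) (𝓝[>] 0) (𝓝 (L / 2)) := by
    have e1 : ∀ t : ℝ, (b t - Z) / t ^ 2
        = ∫ y, Real.exp (-H y) * D y * ((Real.exp (δ t y / 2) - 1) / t ^ 2) := by
      intro t
      rw [hb, hZ, ← integral_sub (hgi t) hi0, ← integral_div]
      refine integral_congr_ae (Eventually.of_forall fun y => ?_)
      simp only
      ring
    have e2 : L / 2 = ∫ y, Real.exp (-H y) * D y * (q y / 2) := by
      rw [hL, ← integral_div]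
      refine integral_congr_ae (Eventually.of_forall fun y => ?_)
      simp only
      ring
    simp_rw [e1]
    rw [e2]
    refine tendsto_integral_filter_of_dominated_convergence
      (fun y => Real.exp (-H y) * D y * (M / 2 * Real.exp (M / 2))) ?_ ?_ (hi0.mul_const _) ?_
    · refine Eventually.of_forall fun t => hi0.aestronglyMeasurable.mul ?_
      have := hδc t
      exact Continuous.aestronglyMeasurable (by fun_prop)
    · have h1 : ∀ᶠ t : ℝ in 𝓝[>] 0, t < 1 := nhdsWithin_le_nhds (gt_mem_nhds one_pos)
      filter_upwards [h1, self_mem_nhdsWithin] with t ht1 ht0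
      have ht0 : 0 < t := ht0
      refine Eventually.of_forall fun y => ?_
      have hs0 : 0 ≤ δ t y / 2 := by linarith [hδ0 t y]
      have hs1 : δ t y / 2 ≤ t ^ 2 * (M / 2) := by linarith [hδM t y]
      have hs2 : δ t y / 2 ≤ M / 2 := hs1.trans
        (mul_le_of_le_one_left (by linarith) (by nlinarith))
      have h2 : 0 ≤ (Real.exp (δ t y / 2) - 1) / t ^ 2 :=
        div_nonneg (by linarith [Real.add_one_le_exp (δ t y / 2)]) (by positivity)
      have h3 : (Real.exp (δ t y / 2) - 1) / t ^ 2 ≤ M / 2 * Real.exp (M / 2) := by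
        rw [div_le_iff₀ (by positivity)]
        have h4 := Real.add_one_le_exp (-(δ t y / 2))
        rw [Real.exp_neg] at h4
        have h5 : Real.exp (δ t y / 2) - 1 ≤ δ t y / 2 * Real.exp (δ t y / 2) := by
          have := mul_le_mul_of_nonneg_right h4 (Real.exp_pos (δ t y / 2)).le
          rw [inv_mul_cancel₀ (Real.exp_pos _).ne'] at this
          linarith
        calc _ ≤ δ t y / 2 * Real.exp (δ t y / 2) := h5
          _ ≤ t ^ 2 * (M / 2) * Real.exp (M / 2) := by gcongr
          _ = _ := by ring
      rw [norm_mul, Real.norm_of_nonneg (mul_nonneg (Real.exp_pos _).le (hD0 y)),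
        Real.norm_of_nonneg h2]
      have := hD0 y
      gcongr
    · have h0 : ∀ᵐ y : EuclideanSpace ℝ (Fin (n + 1)), y ≠ 0 := by simp [ae_iff]
      filter_upwards [h0] with y hy
      refine Tendsto.const_mul _ ?_
      have ht := hK.tendsto_secondDiff hy e
      have hlo : Tendsto (fun t : ℝ => δ t y / t ^ 2 / 2) (𝓝[>] 0) (𝓝 (q y / 2)) :=
        ht.div_const 2
      have hδt : Tendsto (fun t : ℝ => δ t y / 2) (𝓝[>] 0) (𝓝 0) := by
        have hc1 : Continuous fun t : ℝ => δ t y / 2 := by fun_prop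
        have h0 := (hc1.tendsto 0).mono_left (nhdsWithin_le_nhds (s := Ioi (0 : ℝ)))
        convert h0 using 2
        simp [hδ]
        ring
      have hexp : Tendsto (fun t : ℝ => Real.exp (δ t y / 2)) (𝓝[>] 0) (𝓝 1) := by
        simpa [Function.comp_def] using (Real.continuous_exp.tendsto 0).comp hδt
      have hup : Tendsto (fun t : ℝ => δ t y / t ^ 2 / 2 * Real.exp (δ t y / 2)) (𝓝[>] 0)
          (𝓝 (q y / 2)) := by
        simpa using hlo.mul hexp
      refine tendsto_of_tendsto_of_tendsto_of_le_of_le' hlo hup ?_ ?_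
      · filter_upwards [self_mem_nhdsWithin] with t ht0
        have ht0 : 0 < t := ht0
        rw [div_right_comm]
        gcongr
        linarith [Real.add_one_le_exp (δ t y / 2)]
      · filter_upwards [self_mem_nhdsWithin] with t ht0
        have ht0 : 0 < t := ht0
        have h4 := Real.add_one_le_exp (-(δ t y / 2))
        rw [Real.exp_neg] at h4
        have h5 : Real.exp (δ t y / 2) - 1 ≤ δ t y / 2 * Real.exp (δ t y / 2) := by
          have := mul_le_mul_of_nonneg_right h4 (Real.exp_pos (δ t y / 2)).le
          rw [inv_mul_cancel₀ (Real.exp_pos _).ne'] at this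
          linarith
        calc _ ≤ δ t y / 2 * Real.exp (δ t y / 2) / t ^ 2 := by gcongr
          _ = _ := by ring
  have htpow : ∀ k : ℕ, k ≠ 0 → Tendsto (fun t : ℝ => t ^ k) (𝓝[>] 0) (𝓝 0) := by
    intro k hk
    have : Continuous fun t : ℝ => t ^ k := by fun_prop
    simpa [hk] using (this.tendsto 0).mono_left (nhdsWithin_le_nhds (s := Ioi (0 : ℝ)))
  have hbZ : Tendsto b (𝓝[>] 0) (𝓝 Z) := by
    have h1 := ((hlim.mul (htpow 2 two_ne_zero)).add_const Z)
    simp only [mul_zero, zero_add] at h1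
    refine h1.congr' ?_
    filter_upwards [self_mem_nhdsWithin] with t ht0
    have ht0 : 0 < t := ht0
    field_simp
    ring
  have hright : Tendsto (fun t => (b t - Z) / t ^ 2 * (b t + Z)) (𝓝[>] 0)
      (𝓝 (L / 2 * (Z + Z))) := hlim.mul (hbZ.add_const Z)
  have hleft : Tendsto (fun t : ℝ => Z * Q + t ^ 2 * (Q ^ 2 / 4) - t ^ 4 * (R ^ 2 / 36)) (𝓝[>] 0)
      (𝓝 (Z * Q)) := by
    have h1 := ((htpow 2 two_ne_zero).mul_const (Q ^ 2 / 4)).const_add (Z * Q)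
    have h2 := h1.sub ((htpow 4 four_ne_zero).mul_const (R ^ 2 / 36))
    simpa using h2
  have hpos : ∀ᶠ t : ℝ in 𝓝[>] 0, 0 < Z + t ^ 2 * Q / 2 + t ^ 3 * R / 6 := by
    have hc1 : Continuous fun t : ℝ => Z + t ^ 2 * Q / 2 + t ^ 3 * R / 6 := by fun_prop
    have h0 := (hc1.tendsto 0).mono_left (nhdsWithin_le_nhds (s := Ioi (0 : ℝ)))
    simp only [ne_eq, OfNat.ofNat_ne_zero, not_false_eq_true, zero_pow, zero_mul, zero_div,
      add_zero] at h0
    exact h0.eventually (lt_mem_nhds hZ0)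
  -- Subtract `Z²` from both sides of `hPL`, divide by `t²` and let `t → 0`.
  have hfin : Z * Q ≤ L / 2 * (Z + Z) := by
    refine le_of_tendsto_of_tendsto hleft hright ?_
    filter_upwards [hpos, self_mem_nhdsWithin] with t ht ht0
    have ht0 : 0 < t := ht0
    have h1 := hPL t ht.le
    rw [div_mul_eq_mul_div, le_div_iff₀ (by positivity)]
    linarith
  nlinarith

end IsSmoothStrictlyConvexBody

end BrascampLiebMain

/-! ### Integration by parts against the weight `w`. -/

section Divergence

open Filter Topology

variable {n : ℕ}

theorem integral_inner_fderiv_eq_zero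
    {V : EuclideanSpace ℝ (Fin (n + 1)) → EuclideanSpace ℝ (Fin (n + 1))}
    {V' : EuclideanSpace ℝ (Fin (n + 1)) →
      EuclideanSpace ℝ (Fin (n + 1)) →L[ℝ] EuclideanSpace ℝ (Fin (n + 1))}
    (hV : ∀ y, HasFDerivAt V (V' y) y) (e : EuclideanSpace ℝ (Fin (n + 1)))
    (hint : Integrable fun y => (inner ℝ (V y) e : ℝ))
    (hint' : Integrable fun y => (inner ℝ (V' y e) e : ℝ)) :
    ∫ y, inner ℝ (V' y e) e = 0 := by
  have hline : ∀ y, HasLineDerivAt ℝ (fun y => (inner ℝ (V y) e : ℝ)) (inner ℝ (V' y e) e) y e := by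
    intro y
    have h := ((hV y).inner ℝ (hasFDerivAt_const e y)).hasLineDerivAt e
    simpa using h
  have key := integral_bilinear_hasLineDerivAt_right_eq_neg_left_of_integrable
    (μ := (volume : Measure (EuclideanSpace ℝ (Fin (n + 1)))))
    (f := fun _ => (1 : ℝ)) (f' := fun _ => (0 : ℝ)) (v := e)
    (B := ContinuousLinearMap.mul ℝ ℝ) (by simp) (by simpa using hint') (by simpa using hint)
    (fun x _ => by
      simpa using (hasFDerivAt_const (1 : ℝ) x).hasLineDerivAt e) (fun x _ => hline x)
  simpa using key

theorem fderiv_smul_of_zero_homogeneous {w : EuclideanSpace ℝ (Fin (n + 1)) → ℝ}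
    (hw : DifferentiableOn ℝ w {0}ᶜ) (hom : ∀ y, y ≠ 0 → ∀ c : ℝ, 0 < c → w (c • y) = w y)
    {y : EuclideanSpace ℝ (Fin (n + 1))} (hy : y ≠ 0) {c : ℝ} (hc : 0 < c) :
    fderiv ℝ w (c • y) = c⁻¹ • fderiv ℝ w y := by
  have hd : ∀ z, z ≠ 0 → HasFDerivAt w (fderiv ℝ w z) z := fun z hz =>
    (hw.differentiableAt (isOpen_ne.mem_nhds hz)).hasFDerivAt
  have h1 : HasFDerivAt (fun z => w (c • z))
      (fderiv ℝ w (c • y) ∘L (c • ContinuousLinearMap.id ℝ _)) y :=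
    (hd _ (smul_ne_zero hc.ne' hy)).comp y ((hasFDerivAt_id y).const_smul c)
  have h2 : HasFDerivAt (fun z => w (c • z)) (fderiv ℝ w y) y := by
    refine (hd y hy).congr_of_eventuallyEq ?_
    filter_upwards [isOpen_ne.mem_nhds hy] with z hz
    exact hom z hz c hc
  rw [← h1.unique h2]
  ext v
  simp [hc.ne']

theorem halfSqSupport_nonneg (K : Set (EuclideanSpace ℝ (Fin (n + 1))))
    (y : EuclideanSpace ℝ (Fin (n + 1))) : 0 ≤ halfSqSupport K y := by
  rw [halfSqSupport]
  positivity

namespace IsSmoothStrictlyConvexBody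

variable {K : Set (EuclideanSpace ℝ (Fin (n + 1)))} (hK : IsSmoothStrictlyConvexBody K)
include hK

theorem halfSqSupport_pos {y : EuclideanSpace ℝ (Fin (n + 1))} (hy : y ≠ 0) :
    0 < halfSqSupport K y := by
  have := hK.support_pos hy
  rw [halfSqSupport]
  positivity

theorem integrable_exp_mul_weight_mul {w : EuclideanSpace ℝ (Fin (n + 1)) → ℝ}
    (hwd : ∀ y, y ≠ 0 → w y = |(dualityHessian K y).det|)
    {f : EuclideanSpace ℝ (Fin (n + 1)) → ℝ}
    (hf : ContinuousOn f {0}ᶜ) {C a : ℝ} (ha : 0 < a)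
    (hb : ∀ y, y ≠ 0 → |f y| ≤ C * (1 + ‖y‖ ^ 2) ^ 2) :
    Integrable fun y => Real.exp (-a * halfSqSupport K y) * (w y * f y) := by
  refine (hK.integrable_exp_mul_det_mul hf ha hb).congr ?_
  have h0 : ∀ᵐ y : EuclideanSpace ℝ (Fin (n + 1)), y ≠ 0 := by simp [ae_iff]
  filter_upwards [h0] with y hy
  rw [hwd y hy]

variable {w : EuclideanSpace ℝ (Fin (n + 1)) → ℝ} (hw : ContDiffOn ℝ 1 w {0}ᶜ)
  (hwd : ∀ y, y ≠ 0 → w y = |(dualityHessian K y).det|)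
include hw hwd

/-- The derivative of the degree-0 weight has degree -1 and may be singular at 0; in later
integrands the linear growth of `T` compensates. -/
theorem exists_fderiv_weight_bound :
    ∃ C : ℝ, 0 ≤ C ∧ ∀ y, y ≠ 0 → ‖y‖ * ‖fderiv ℝ w y‖ ≤ C := by
  obtain ⟨C, hC, h⟩ := exists_norm_le_of_zero_homogeneous (f := fun y => ‖y‖ • fderiv ℝ w y)
    (continuousOn_id.norm.smul (hw.continuousOn_fderiv_of_isOpen isOpen_compl_singleton le_rfl)) (fun y hy c hc => by
      rw [fderiv_smul_of_zero_homogeneous (hw.differentiableOn one_ne_zero) (fun y hy c hc => by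
        rw [hwd _ (smul_ne_zero hc.ne' hy), hwd y hy, hK.dualityHessian_smul hy hc]) hy hc,
        smul_smul, norm_smul, Real.norm_of_nonneg hc.le]
      congr 1
      field_simp)
  refine ⟨C, hC, fun y hy => ?_⟩
  simpa [norm_smul] using h y hy

theorem exists_fderiv_weight_mul_inner_bound (e v : EuclideanSpace ℝ (Fin (n + 1))) :
    ∃ C : ℝ, ∀ y, y ≠ 0 → |fderiv ℝ w y e * inner ℝ (dualityMap K y) v|
      ≤ C * (1 + ‖y‖ ^ 2) ^ 2 := by
  obtain ⟨C₁, hC₁, h₁⟩ := hK.exists_fderiv_weight_bound hw hwd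
  obtain ⟨C₂, hC₂, h₂⟩ := hK.exists_dualityMap_bound
  refine ⟨C₁ * C₂ * ‖e‖ * ‖v‖, fun y hy => ?_⟩
  calc |fderiv ℝ w y e * inner ℝ (dualityMap K y) v|
      = ‖fderiv ℝ w y e‖ * |inner ℝ (dualityMap K y) v| := by rw [abs_mul, Real.norm_eq_abs]
    _ ≤ (‖fderiv ℝ w y‖ * ‖e‖) * ((C₂ * ‖y‖) * ‖v‖) := by
        gcongr
        · exact (fderiv ℝ w y).le_opNorm e
        · exact (abs_real_inner_le_norm _ _).trans (by gcongr; exact h₂ y)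
    _ = (‖y‖ * ‖fderiv ℝ w y‖) * (C₂ * ‖e‖ * ‖v‖) := by ring
    _ ≤ C₁ * (C₂ * ‖e‖ * ‖v‖) := by gcongr; exact h₁ y hy
    _ = C₁ * C₂ * ‖e‖ * ‖v‖ * 1 := by ring
    _ ≤ _ := by
        gcongr
        nlinarith [sq_nonneg ‖y‖]

theorem integrable_exp_mul_fderiv_weight (e v : EuclideanSpace ℝ (Fin (n + 1))) {a : ℝ}
    (ha : 0 < a) :
    Integrable fun y => Real.exp (-a * halfSqSupport K y) *
      (fderiv ℝ w y e * inner ℝ (dualityMap K y) v) := by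
  obtain ⟨C, h⟩ := hK.exists_fderiv_weight_mul_inner_bound hw hwd e v
  exact hK.integrable_exp_mul (((hw.continuousOn_fderiv_of_isOpen isOpen_compl_singleton le_rfl).clm_apply
    continuousOn_const).mul (hK.continuousOn_dualityMap.inner continuousOn_const)) ha h

/-- The vector field `(e^{-H} - e^{-(k+1)H}) w ∇H`, with `H` half the square of the support
function, is differentiable everywhere. -/
theorem hasFDerivAt_cutoff_field (k : ℕ) (y : EuclideanSpace ℝ (Fin (n + 1))) :
    HasFDerivAt (fun y => ((Real.exp (-halfSqSupport K y)
        - Real.exp (-(k + 1 : ℝ) * halfSqSupport K y)) * w y) • dualityMap K y)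
      (if y = 0 then 0 else
        ((Real.exp (-halfSqSupport K y) - Real.exp (-(k + 1 : ℝ) * halfSqSupport K y)) * w y) •
          dualityHessian K y +
        (((Real.exp (-halfSqSupport K y) - Real.exp (-(k + 1 : ℝ) * halfSqSupport K y)) •
            fderiv ℝ w y +
          ((-Real.exp (-halfSqSupport K y) +
            (k + 1) * Real.exp (-(k + 1 : ℝ) * halfSqSupport K y)) * w y) •
              innerSL ℝ (dualityMap K y)).smulRight (dualityMap K y))) y := by
  have hH := hK.continuous_halfSqSupport
  split_ifs with hy
  · subst hy
    -- At the origin the weight is bounded, `T` is `O(|z|)` and the exponential factor tends to 0,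
    -- so the field is `o(|z|)`.
    rw [hasFDerivAt_iff_isLittleO_nhds_zero]
    simp only [zero_add, hK.dualityMap_zero, smul_zero, sub_zero, zero_apply]
    obtain ⟨C₁, hC₁, h₁⟩ := hK.exists_dualityMap_bound
    obtain ⟨C₂, hC₂, h₂⟩ := hK.exists_det_bound
    set ρ : EuclideanSpace ℝ (Fin (n + 1)) → ℝ := fun z => Real.exp (-halfSqSupport K z)
        - Real.exp (-(k + 1 : ℝ) * halfSqSupport K z) with hρ
    have hρ0 : ρ =o[𝓝 0] fun _ => (1 : ℝ) := by
      rw [Asymptotics.isLittleO_one_iff]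
      have hc : Continuous ρ := by fun_prop
      have := hc.tendsto 0
      simpa [hρ, hK.halfSqSupport_zero] using this
    have hbig : (fun z => ‖w z • dualityMap K z‖) =O[𝓝 0] fun z => z := by
      refine Asymptotics.IsBigO.of_bound (C₂ * C₁) (Eventually.of_forall fun z => ?_)
      rcases eq_or_ne z 0 with rfl | hz
      · simp [hK.dualityMap_zero]
      · rw [norm_norm, norm_smul, hwd z hz, norm_abs_eq_norm, mul_assoc]
        exact mul_le_mul (h₂ z hz) (h₁ z) (norm_nonneg _) hC₂
    have h := hρ0.smul_isBigO (Asymptotics.isBigO_norm_left.mp hbig)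
    simp only [smul_smul, one_smul] at h
    exact h
  · have h1 := hK.hasFDerivAt_halfSqSupport hy
    have h2 := (hw.differentiableOn one_ne_zero).differentiableAt (isOpen_ne.mem_nhds hy)
    have h3 := (h1.neg.exp.sub (h1.const_mul (-(k + 1 : ℝ))).exp).mul h2.hasFDerivAt
    refine (h3.smul (hK.hasFDerivAt_dualityMap hy)).congr_fderiv ?_
    ext1 v
    simp only [add_apply, smul_apply, ContinuousLinearMap.smulRight_apply, sub_apply, neg_apply,
      smul_eq_mul, Pi.sub_apply, Pi.neg_apply]
    congr 2
    ring

/-- Formally, integrating `∂_e (e^{-H} w ⟨T, e⟩)` equates this integral with `∫ e^{-H} w ⟨T, e⟩² - ∫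
e^{-H} w ⟨D²H e, e⟩`, which Brascamp–Lieb makes nonpositive. As `w` need not extend continuously to
0, the factor `e^{-H}` is first replaced by `e^{-H} - e^{-(k+1)H}`, which vanishes at 0 and tends to
`e^{-H}` off 0. -/
theorem integral_exp_mul_fderiv_weight_nonpos (hc : centroidOf K = 0)
    (e : EuclideanSpace ℝ (Fin (n + 1))) :
    ∫ y, Real.exp (-halfSqSupport K y) * (fderiv ℝ w y e * inner ℝ (dualityMap K y) e) ≤ 0 := by
  set H := halfSqSupport K with hH
  set τ : EuclideanSpace ℝ (Fin (n + 1)) → ℝ := fun y => inner ℝ (dualityMap K y) e with hτ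
  set q : EuclideanSpace ℝ (Fin (n + 1)) → ℝ := fun y => inner ℝ (dualityHessian K y e) e with hq
  set d : EuclideanSpace ℝ (Fin (n + 1)) → ℝ := fun y => fderiv ℝ w y e * τ y with hd
  have hae : ∀ᵐ y : EuclideanSpace ℝ (Fin (n + 1)), y ≠ 0 := by simp [ae_iff]
  have hHc : Continuous H := hK.continuous_halfSqSupport
  have hτc : ContinuousOn τ {0}ᶜ := hK.continuousOn_dualityMap.inner continuousOn_const
  have hqc : ContinuousOn q {0}ᶜ :=
    (hK.continuousOn_dualityHessian.clm_apply continuousOn_const).inner continuousOn_const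
  obtain ⟨C₁, hC₁, h₁⟩ := hK.exists_dualityMap_bound
  obtain ⟨C₂, hC₂, h₂⟩ := hK.exists_dualityHessian_bound
  have hτb : ∀ y, |τ y| ≤ C₁ * ‖e‖ * ‖y‖ := fun y =>
    (abs_real_inner_le_norm _ _).trans (by
      calc _ ≤ C₁ * ‖y‖ * ‖e‖ := by gcongr; exact h₁ y
        _ = _ := by ring)
  have iτ : ∀ a : ℝ, 0 < a → Integrable fun y => Real.exp (-a * H y) * (w y * τ y) := fun a ha =>
    hK.integrable_exp_mul_weight_mul hwd hτc (C := C₁ * ‖e‖) ha fun y _ =>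
      (hτb y).trans (by gcongr; nlinarith [sq_nonneg (‖y‖ - 1), sq_nonneg (‖y‖ ^ 2)])
  have iτ2 : ∀ a : ℝ, 0 < a → Integrable fun y => Real.exp (-a * H y) * (w y * τ y ^ 2) :=
    fun a ha => hK.integrable_exp_mul_weight_mul hwd (hτc.pow 2) (C := (C₁ * ‖e‖) ^ 2) ha
      fun y _ => by
        rw [Pi.pow_apply, abs_pow]
        calc |τ y| ^ 2 ≤ (C₁ * ‖e‖ * ‖y‖) ^ 2 := by gcongr; exact hτb y
          _ = (C₁ * ‖e‖) ^ 2 * ‖y‖ ^ 2 := mul_pow _ _ _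
          _ ≤ _ := by gcongr; nlinarith [sq_nonneg ‖y‖, sq_nonneg (‖y‖ ^ 2)]
  have iq : ∀ a : ℝ, 0 < a → Integrable fun y => Real.exp (-a * H y) * (w y * q y) :=
    fun a ha => hK.integrable_exp_mul_weight_mul hwd hqc (C := C₂ * ‖e‖ * ‖e‖) ha fun y hy => by
      calc |q y| ≤ ‖dualityHessian K y e‖ * ‖e‖ := abs_real_inner_le_norm _ _
        _ ≤ C₂ * ‖e‖ * ‖e‖ := by
            gcongr
            exact (dualityHessian K y).le_of_opNorm_le (h₂ y hy) e
        _ = C₂ * ‖e‖ * ‖e‖ * 1 := (mul_one _).symm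
        _ ≤ _ := by
            gcongr
            nlinarith [sq_nonneg ‖y‖]
  have id : ∀ a : ℝ, 0 < a → Integrable fun y => Real.exp (-a * H y) * d y := fun a ha =>
    hK.integrable_exp_mul_fderiv_weight hw hwd e e ha
  have iqd : ∀ a : ℝ, 0 < a → Integrable fun y => Real.exp (-a * H y) * (w y * q y + d y) :=
    fun a ha => by
      simpa only [mul_add, Pi.add_def] using (iq a ha).add (id a ha)
  have one : ∀ y, Real.exp (-(1 : ℝ) * H y) = Real.exp (-H y) := fun y => by simp
  -- The cutoff contributes the extra term `(k + 1) e^{-(k+1)H} w τ² ≥ 0`. Dropping it leaves an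
  -- inequality in the needed direction, so its limit is never computed.
  have step : ∀ k : ℕ, ∫ y, (Real.exp (-H y) - Real.exp (-(k + 1 : ℝ) * H y)) * (w y * q y + d y)
      ≤ ∫ y, Real.exp (-H y) * (w y * τ y ^ 2) := by
    intro k
    have hk : (0 : ℝ) < k + 1 := by positivity
    have ha : Integrable fun y =>
        (Real.exp (-H y) - Real.exp (-(k + 1 : ℝ) * H y)) * (w y * q y + d y) := by
      simpa only [one, sub_mul, Pi.sub_def] using (iqd 1 one_pos).sub (iqd _ hk)
    have hb : Integrable fun y => Real.exp (-H y) * (w y * τ y ^ 2) := by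
      simpa only [one] using iτ2 1 one_pos
    have hc : Integrable fun y =>
        (k + 1 : ℝ) * (Real.exp (-(k + 1 : ℝ) * H y) * (w y * τ y ^ 2)) :=
      (iτ2 _ hk).const_mul _
    have hV : Integrable fun y => (inner ℝ (((Real.exp (-H y)
        - Real.exp (-(k + 1 : ℝ) * H y)) * w y) • dualityMap K y) e : ℝ) := by
      simp only [real_inner_smul_left]
      simpa only [one, sub_mul, mul_assoc, Pi.sub_def] using (iτ 1 one_pos).sub (iτ _ hk)
    have hV' : (fun y => (Real.exp (-H y) - Real.exp (-(k + 1 : ℝ) * H y)) * (w y * q y + d y)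
        - Real.exp (-H y) * (w y * τ y ^ 2)
        + (k + 1 : ℝ) * (Real.exp (-(k + 1 : ℝ) * H y) * (w y * τ y ^ 2))) =ᵐ[volume]
        fun y => inner ℝ ((if y = 0 then 0 else
        ((Real.exp (-H y) - Real.exp (-(k + 1 : ℝ) * H y)) * w y) •
          dualityHessian K y +
        (((Real.exp (-H y) - Real.exp (-(k + 1 : ℝ) * H y)) •
            fderiv ℝ w y +
          ((-Real.exp (-H y) +
            (k + 1) * Real.exp (-(k + 1 : ℝ) * H y)) * w y) •
              innerSL ℝ (dualityMap K y)).smulRight (dualityMap K y)) :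
                EuclideanSpace ℝ (Fin (n + 1)) →L[ℝ] EuclideanSpace ℝ (Fin (n + 1))) e) e := by
      filter_upwards [hae] with y hy
      simp only [if_neg hy, add_apply, smul_apply, ContinuousLinearMap.smulRight_apply,
        inner_add_left, real_inner_smul_left, smul_eq_mul, innerSL_apply_apply, hd, hq, hτ]
      ring
    have hdiv := integral_inner_fderiv_eq_zero (hK.hasFDerivAt_cutoff_field hw hwd k) e hV
      (((ha.sub hb).add hc).congr hV')
    rw [← integral_congr_ae hV', integral_add
      (f := fun y => (Real.exp (-H y) - Real.exp (-(k + 1 : ℝ) * H y)) * (w y * q y + d y)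
        - Real.exp (-H y) * (w y * τ y ^ 2)) (ha.sub hb) hc, integral_sub ha hb] at hdiv
    have hpos : 0 ≤ ∫ y, (k + 1 : ℝ) * (Real.exp (-(k + 1 : ℝ) * H y) * (w y * τ y ^ 2)) := by
      refine integral_nonneg_of_ae ?_
      filter_upwards [hae] with y hy
      have : 0 ≤ w y := hwd y hy ▸ abs_nonneg _
      simp only [Pi.zero_apply]
      positivity
    linarith
  have hlim : Tendsto (fun k : ℕ => ∫ y, (Real.exp (-H y) - Real.exp (-(k + 1 : ℝ) * H y)) *
      (w y * q y + d y)) atTop (𝓝 (∫ y, Real.exp (-H y) * (w y * q y + d y))) := by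
    have i1 : Integrable fun y => Real.exp (-H y) * (w y * q y + d y) := by
      simpa only [one] using iqd 1 one_pos
    refine tendsto_integral_of_dominated_convergence
      (fun y => ‖Real.exp (-H y) * (w y * q y + d y)‖) (fun k => ?_) i1.norm (fun k => ?_) ?_
    · have hk : (0 : ℝ) < k + 1 := by positivity
      have := i1.sub (iqd _ hk)
      simpa only [sub_mul, Pi.sub_def] using this.aestronglyMeasurable
    · refine Eventually.of_forall fun y => ?_
      rw [norm_mul, norm_mul]
      gcongr
      have h1 : Real.exp (-(k + 1 : ℝ) * H y) ≤ Real.exp (-H y) := by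
        refine Real.exp_le_exp.mpr ?_
        have := halfSqSupport_nonneg K y
        have hk : (0 : ℝ) ≤ k := by positivity
        nlinarith [mul_nonneg hk this]
      rw [Real.norm_of_nonneg (by linarith), Real.norm_of_nonneg (Real.exp_pos _).le]
      linarith [Real.exp_pos (-(k + 1 : ℝ) * H y)]
    · filter_upwards [hae] with y hy
      have hHy := hK.halfSqSupport_pos hy
      have h1 : Tendsto (fun k : ℕ => Real.exp (-(k + 1 : ℝ) * H y)) atTop (𝓝 0) := by
        have h2 : Tendsto (fun k : ℕ => (k + 1 : ℝ) * H y) atTop atTop :=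
          (tendsto_natCast_atTop_atTop.atTop_add tendsto_const_nhds).atTop_mul_const hHy
        simpa only [Function.comp_def, ← neg_mul] using Real.tendsto_exp_neg_atTop_nhds_zero.comp h2
      simpa using (h1.const_sub (Real.exp (-H y))).mul_const (w y * q y + d y)
  have hle := le_of_tendsto' hlim step
  have hBL := hK.integral_inner_sq_le hc e
  have e1 : ∫ y, Real.exp (-H y) * (|(dualityHessian K y).det| * τ y ^ 2)
      = ∫ y, Real.exp (-H y) * (w y * τ y ^ 2) := by
    refine integral_congr_ae ?_
    filter_upwards [hae] with y hy
    rw [hwd y hy]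
  have e2 : ∫ y, Real.exp (-H y) * (|(dualityHessian K y).det| * q y)
      = ∫ y, Real.exp (-H y) * (w y * q y) := by
    refine integral_congr_ae ?_
    filter_upwards [hae] with y hy
    rw [hwd y hy]
  have e3 : ∫ y, Real.exp (-H y) * (w y * q y + d y)
      = (∫ y, Real.exp (-H y) * (w y * q y)) + ∫ y, Real.exp (-H y) * d y := by
    simp only [mul_add]
    exact integral_add (by simpa only [one] using iq 1 one_pos)
      (by simpa only [one] using id 1 one_pos)
  have hBL' : ∫ y, Real.exp (-H y) * (|(dualityHessian K y).det| * τ y ^ 2)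
      ≤ ∫ y, Real.exp (-H y) * (|(dualityHessian K y).det| * q y) := hBL
  rw [e1, e2] at hBL'
  rw [e3] at hle
  have : ∫ y, Real.exp (-H y) * d y ≤ 0 := by linarith
  exact this

/-- If the weight `w = |det D²H|` is nondecreasing along `∇H`, then it is constant along it. -/
theorem fderiv_weight_dualityMap_eq_zero (hc : centroidOf K = 0)
    (hG : ∀ y, y ≠ 0 → 0 ≤ fderiv ℝ w y (dualityMap K y))
    {y : EuclideanSpace ℝ (Fin (n + 1))} (hy : y ≠ 0) :
    fderiv ℝ w y (dualityMap K y) = 0 := by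
  set b := EuclideanSpace.basisFun (Fin (n + 1)) ℝ
  have hsum : ∀ z, Real.exp (-halfSqSupport K z) * fderiv ℝ w z (dualityMap K z)
      = ∑ i, Real.exp (-halfSqSupport K z) *
        (fderiv ℝ w z (b i) * inner ℝ (dualityMap K z) (b i)) := by
    intro z
    rw [← Finset.mul_sum]
    congr 1
    conv_lhs => rw [← b.sum_repr (dualityMap K z)]
    rw [map_sum]
    refine Finset.sum_congr rfl fun i _ => ?_
    rw [map_smul, b.repr_apply_apply, smul_eq_mul, real_inner_comm, mul_comm]
  have hint : ∀ i, Integrable fun z => Real.exp (-halfSqSupport K z) *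
      (fderiv ℝ w z (b i) * inner ℝ (dualityMap K z) (b i)) := fun i => by
    simpa using hK.integrable_exp_mul_fderiv_weight hw hwd (b i) (b i) one_pos
  have hle : ∫ z, Real.exp (-halfSqSupport K z) * fderiv ℝ w z (dualityMap K z) ≤ 0 := by
    simp_rw [hsum]
    rw [integral_finsetSum _ fun i _ => hint i]
    exact Finset.sum_nonpos fun i _ => hK.integral_exp_mul_fderiv_weight_nonpos hw hwd hc (b i)
  have hae : ∀ᵐ y : EuclideanSpace ℝ (Fin (n + 1)), y ≠ 0 := by simp [ae_iff]
  have hnn : 0 ≤ᵐ[volume] fun z =>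
      Real.exp (-halfSqSupport K z) * fderiv ℝ w z (dualityMap K z) := by
    filter_upwards [hae] with z hz
    exact mul_nonneg (Real.exp_pos _).le (hG z hz)
  have hi : Integrable fun z => Real.exp (-halfSqSupport K z) * fderiv ℝ w z (dualityMap K z) := by
    simp_rw [hsum]
    exact integrable_finsetSum _ fun i _ => hint i
  -- A nonnegative integrand with nonpositive integral vanishes almost everywhere, hence everywhere
  -- off 0 by continuity.
  have h0 := (integral_eq_zero_iff_of_nonneg_ae hnn hi).mp
    (le_antisymm hle (integral_nonneg_of_ae hnn))
  have hcont : ContinuousOn (fun z =>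
      Real.exp (-halfSqSupport K z) * fderiv ℝ w z (dualityMap K z)) {0}ᶜ := by
    have hHc := hK.continuous_halfSqSupport
    exact ContinuousOn.mul (by fun_prop)
      ((hw.continuousOn_fderiv_of_isOpen isOpen_compl_singleton le_rfl).clm_apply hK.continuousOn_dualityMap)
  have h1 := Measure.eqOn_open_of_ae_eq (ae_restrict_of_ae h0) isOpen_compl_singleton hcont
    continuousOn_const hy
  exact (mul_eq_zero.mp h1).resolve_left (Real.exp_pos _).ne'

end IsSmoothStrictlyConvexBody

end Divergence

/-! ### The equality cases, and bodies with radial contact points. -/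

section Rigidity

open Filter Topology

theorem hasDerivAt_norm_of_ne_zero {E : Type*} [NormedAddCommGroup E] [InnerProductSpace ℝ E]
    {c : ℝ → E} {c' : E} {r : ℝ} (hc : HasDerivAt c c' r) (h0 : c r ≠ 0) :
    HasDerivAt (fun t => ‖c t‖) (inner ℝ (c r) c' / ‖c r‖) r := by
  have h := hc.norm_sq.sqrt (by positivity)
  simp only [Real.sqrt_sq (norm_nonneg _)] at h
  convert! h using 1
  rw [mul_div_mul_left _ _ two_ne_zero]

theorem hasDerivAt_uncurry_comp {φ : ℝ → ℝ → ℝ} {α β : ℝ → ℝ} {α' β' r : ℝ}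
    (hφ : DifferentiableAt ℝ (Function.uncurry φ) (α r, β r)) (hα : HasDerivAt α α' r)
    (hβ : HasDerivAt β β' r) :
    HasDerivAt (fun t => φ (α t) (β t))
      (α' * deriv (fun s => φ s (β r)) (α r) + β' * deriv (fun t => φ (α r) t) (β r)) r := by
  have h1 := (hφ.hasFDerivAt.comp_hasDerivAt (α r)
    ((hasDerivAt_id (α r)).prodMk (hasDerivAt_const (α r) (β r)))).deriv
  have h2 := (hφ.hasFDerivAt.comp_hasDerivAt (β r)
    ((hasDerivAt_const (β r) (α r)).prodMk (hasDerivAt_id (β r)))).deriv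
  have h := hφ.hasFDerivAt.comp_hasDerivAt r (hα.prodMk hβ)
  have e1 : deriv (fun s => φ s (β r)) (α r)
      = fderiv ℝ (Function.uncurry φ) (α r, β r) (1, 0) := h1
  have e2 : deriv (fun t => φ (α r) t) (β r)
      = fderiv ℝ (Function.uncurry φ) (α r, β r) (0, 1) := h2
  rw [e1, e2]
  have e3 : fderiv ℝ (Function.uncurry φ) (α r, β r) (α', β')
      = α' * fderiv ℝ (Function.uncurry φ) (α r, β r) (1, 0)
        + β' * fderiv ℝ (Function.uncurry φ) (α r, β r) (0, 1) := by
    rw [← smul_eq_mul, ← smul_eq_mul, ← map_smul, ← map_smul, ← map_add]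
    simp
  rw [← e3]
  exact h

/-- A nonnegative quadratic form evaluated on `g + r A g` has no constant term, so its linear
coefficient `2‖A g‖²` must vanish. -/
theorem eq_zero_of_inner_self_eq_zero {E : Type*} [NormedAddCommGroup E] [InnerProductSpace ℝ E]
    {A : E →L[ℝ] E} (hsymm : ∀ v w, inner ℝ (A v) w = inner ℝ (A w) v)
    (hpos : ∀ v, 0 ≤ inner ℝ (A v) v) {g : E} (hg : inner ℝ (A g) g = 0) : A g = 0 := by
  by_contra hne
  have hN : 0 < inner ℝ (A g) (A g) := real_inner_self_pos.mpr hne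
  have hc := hpos (A g)
  set N : ℝ := inner ℝ (A g) (A g) with hNdef
  set c : ℝ := inner ℝ (A (A g)) (A g) with hcdef
  have key : ∀ r : ℝ, 0 ≤ 2 * r * N + r ^ 2 * c := by
    intro r
    have h := hpos (g + r • A g)
    simp only [map_add, map_smul, inner_add_left, inner_add_right, real_inner_smul_left,
      real_inner_smul_right, hg, hsymm (A g) g] at h
    linarith
  -- The denominator `c + 1` in place of the minimizer's `c` also covers `c = 0`.
  have h := key (-(N / (c + 1)))
  have h2 : 2 * -(N / (c + 1)) * N + (-(N / (c + 1))) ^ 2 * c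
      = -(N ^ 2 * (c + 2)) / (c + 1) ^ 2 := by
    field_simp
    ring
  rw [h2] at h
  have : 0 < N ^ 2 * (c + 2) / (c + 1) ^ 2 := by positivity
  rw [neg_div] at h
  linarith

variable {n : ℕ}

namespace IsSmoothStrictlyConvexBody

variable {K : Set (EuclideanSpace ℝ (Fin (n + 1)))} (hK : IsSmoothStrictlyConvexBody K)
  {y : EuclideanSpace ℝ (Fin (n + 1))}
include hK

/-- Here `D²h` kills both `X` and `y`, so on their span `D²H` is just `X ⊗ X`, which kills `h X -
|X|² y`. Nondegeneracy forces that vector to be 0. -/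
theorem eq_smul_of_inner_supportHessian_eq_zero (hy : y ≠ 0)
    (hdet : (dualityHessian K y).det ≠ 0)
    (h : inner ℝ (supportHessian K y (gradient (supportFunction K) y))
      (gradient (supportFunction K) y) = 0) :
    ‖y‖ ^ 2 • gradient (supportFunction K) y = supportFunction K y • y := by
  set X := gradient (supportFunction K) y with hX
  have hAX : supportHessian K y X = 0 := eq_zero_of_inner_self_eq_zero
    (hK.inner_supportHessian_comm hy) (hK.inner_supportHessian_self_nonneg hy) h
  have hh := hK.support_pos hy
  have hXy : inner ℝ X y = supportFunction K y := hK.inner_gradient hy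
  have hB : dualityHessian K y (supportFunction K y • X - ‖X‖ ^ 2 • y) = 0 := by
    simp only [dualityHessian, add_apply, smul_apply, ContinuousLinearMap.smulRight_apply, map_sub,
      map_smul, hAX, hK.supportHessian_self hy, ← hX, innerSL_apply_apply, hXy,
      real_inner_self_eq_norm_sq, smul_zero, zero_add]
    rw [smul_comm, sub_self]
  have hinj : Function.Injective (dualityHessian K y) := by
    exact (LinearMap.equivOfDetNeZero (dualityHessian K y).toLinearMap hdet).injective
  have h1 : supportFunction K y • X = ‖X‖ ^ 2 • y :=
    sub_eq_zero.mp (hinj (hB.trans (map_zero _).symm))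
  have h2 := congrArg (fun v => inner ℝ v y) h1
  simp only [real_inner_smul_left, hXy, real_inner_self_eq_norm_sq] at h2
  refine smul_right_injective _ hh.ne' ?_
  simp only
  rw [smul_comm, h1, smul_smul, smul_smul, h2, mul_comm]

/-- The equality case of Cauchy–Schwarz for `⟨X, y⟩ = h`. -/
theorem eq_smul_of_norm_mul_norm_eq (hy : y ≠ 0)
    (h : ‖gradient (supportFunction K) y‖ ^ 2 * ‖y‖ ^ 2 = supportFunction K y ^ 2) :
    ‖y‖ ^ 2 • gradient (supportFunction K) y = supportFunction K y • y := by
  set X := gradient (supportFunction K) y with hX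
  have hXy : inner ℝ X y = supportFunction K y := hK.inner_gradient hy
  rw [← sub_eq_zero, ← norm_eq_zero, ← sq_eq_zero_iff, norm_sub_sq_real, norm_smul, norm_smul,
    real_inner_smul_left, real_inner_smul_right, hXy, Real.norm_of_nonneg (hK.support_pos hy).le,
    Real.norm_of_nonneg (by positivity)]
  linear_combination ‖y‖ ^ 2 * h

/-- A body whose position vector is everywhere normal to its boundary is a ball. -/
theorem frontier_eq_sphere (hn : 1 ≤ n)
    (h : ∀ y, y ≠ 0 → ‖y‖ ^ 2 • gradient (supportFunction K) y = supportFunction K y • y) :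
    ∃ r : ℝ, 0 < r ∧ frontier K = Metric.sphere (0 : EuclideanSpace ℝ (Fin (n + 1))) r := by
  -- This is where `n ≥ 1` enters: a punctured line would be disconnected.
  have hconn : IsPreconnected ({0}ᶜ : Set (EuclideanSpace ℝ (Fin (n + 1)))) := by
    refine (isConnected_compl_singleton_of_one_lt_rank ?_ 0).isPreconnected
    rw [← Module.finrank_eq_rank]
    simp only [finrank_euclideanSpace, Fintype.card_fin]
    exact_mod_cast Nat.lt_succ_of_le hn
  have hd : ∀ y : EuclideanSpace ℝ (Fin (n + 1)), y ≠ 0 →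
      HasFDerivAt (fun z => supportFunction K z ^ 2 / ‖z‖ ^ 2)
        (0 : EuclideanSpace ℝ (Fin (n + 1)) →L[ℝ] ℝ) y := by
    intro y hy
    have hy' : ‖y‖ ^ 2 ≠ 0 := by positivity
    have h1 := ((hK.hasFDerivAt_supportFunction hy).pow 2).mul
      ((hasDerivAt_inv hy').comp_hasFDerivAt y (hasStrictFDerivAt_norm_sq y).hasFDerivAt)
    refine h1.congr_fderiv ?_
    ext v
    have h2 := congrArg (fun u => inner ℝ u v) (h y hy)
    simp only [real_inner_smul_left] at h2
    simp only [add_apply, smul_apply, innerSL_apply_apply, smul_eq_mul, zero_apply,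
      Function.comp_apply, nsmul_eq_mul]
    field_simp
    push_cast
    linear_combination 2 * supportFunction K y * h2
  obtain ⟨a, ha⟩ := isOpen_compl_singleton.exists_is_const_of_fderiv_eq_zero hconn
    (fun y hy => (hd y hy).differentiableAt.differentiableWithinAt) fun y hy => (hd y hy).fderiv
  have hsup : ∀ y : EuclideanSpace ℝ (Fin (n + 1)), y ≠ 0 →
      supportFunction K y = √a * ‖y‖ := by
    intro y hy
    have hy' : 0 < ‖y‖ := norm_pos_iff.mpr hy
    have := hK.support_pos hy
    rw [← ha y hy, Real.sqrt_div (sq_nonneg _), Real.sqrt_sq this.le, Real.sqrt_sq hy'.le]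
    field_simp
  have hgrad : ∀ y : EuclideanSpace ℝ (Fin (n + 1)), y ≠ 0 →
      gradient (supportFunction K) y = (√a / ‖y‖) • y := by
    intro y hy
    have hy' : ‖y‖ ^ 2 ≠ 0 := by positivity
    refine smul_right_injective _ hy' ?_
    simp only
    rw [h y hy, hsup y hy, smul_smul]
    congr 1
    have : ‖y‖ ≠ 0 := norm_ne_zero_iff.mpr hy
    field_simp
  have hr : 0 < √a := by
    obtain ⟨y, hy⟩ := exists_ne (0 : EuclideanSpace ℝ (Fin (n + 1)))
    have := hK.support_pos hy
    rw [hsup y hy] at this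
    exact pos_of_mul_pos_left this (norm_nonneg _)
  refine ⟨√a, hr, Subset.antisymm (fun q hq => ?_) fun z hz => ?_⟩
  · obtain ⟨_, _, U, N, _, hqU, _, hN, _⟩ := hK.curvature_pos q hq
    have hu := hN q ⟨hq, hqU⟩
    have hX := gradient_supportFunction_eq hK.isCompact hK.strictConvex hu.ne_zero hu.1
      (hu.inner_eq hK.isCompact)
    rw [mem_sphere_zero_iff_norm, ← hX, hgrad _ hu.ne_zero, norm_smul, hu.2.1]
    simp
  · rw [mem_sphere_zero_iff_norm] at hz
    have hz0 : z ≠ 0 := norm_pos_iff.mp (hz ▸ hr)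
    have h1 := hK.gradient_mem_frontier hz0
    rwa [hgrad z hz0, hz, div_self hr.ne', one_smul] at h1

end IsSmoothStrictlyConvexBody

end Rigidity

/-! ### The curvature equation and the conclusion. -/

theorem theorem1p3 (n : ℕ) (hn : 1 ≤ n) (φ : ℝ → ℝ → ℝ)
    (hφ_pos : ∀ s t : ℝ, 0 < s → 0 < t → 0 < φ s t)
    (hφ_smooth : ContDiffOn ℝ 1 (Function.uncurry φ) (Set.Ioi 0 ×ˢ Set.Ioi 0))
    (hφ_one : ∀ s t : ℝ, 0 < s → 0 < t → 0 ≤ deriv (fun s' => φ s' t) s)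
    (hφ_two : ∀ s t : ℝ, 0 < s → 0 < t → 0 ≤ deriv (fun t' => φ s t') t)
    (hφ_strict : ∀ s t : ℝ, 0 < s → 0 < t →
      0 < deriv (fun s' => φ s' t) s ∨ 0 < deriv (fun t' => φ s t') t)
    (K : Set (EuclideanSpace ℝ (Fin (n + 1))))
    (hK : IsSmoothStrictlyConvexBody K)
    (hcentred : centroidOf K = 0)
    (heq : ∀ x : EuclideanSpace ℝ (Fin (n + 1)), ‖x‖ = 1 →
      φ (supportFunction K x) ‖gradient (supportFunction K) x‖ * gaussCurvature K x
        = supportFunction K x ^ (n + 2)) :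
    ∃ r : ℝ, 0 < r ∧ frontier K = Metric.sphere (0 : EuclideanSpace ℝ (Fin (n + 1))) r := by
  set h := supportFunction K with hh
  set X := gradient (supportFunction K) with hX
  set w : EuclideanSpace ℝ (Fin (n + 1)) → ℝ := fun y => φ (h y / ‖y‖) ‖X y‖ with hw
  have hhpos : ∀ y, y ≠ 0 → 0 < h y := fun y hy => hK.support_pos hy
  have hXpos : ∀ y, y ≠ 0 → 0 < ‖X y‖ := fun y hy => norm_pos_iff.mpr (hK.gradient_ne_zero hy)
  -- Both sides have degree 0, so the equation on the unit sphere extends to all `y ≠ 0`.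
  have hdet : ∀ y, y ≠ 0 → (dualityHessian K y).det = w y := by
    intro y hy
    have hy' : 0 < ‖y‖ := norm_pos_iff.mpr hy
    have hx : ‖‖y‖⁻¹ • y‖ = 1 := norm_smul_inv_norm (𝕜 := ℝ) hy
    have hx0 : ‖y‖⁻¹ • y ≠ 0 := smul_ne_zero (by positivity) hy
    have e1 := hK.det_dualityHessian hx
    have e2 := heq _ hx
    rw [hK.dualityHessian_smul hy (by positivity)] at e1
    have hpow : 0 < h (‖y‖⁻¹ • y) ^ (n + 2) := pow_pos (hhpos _ hx0) _
    -- If the determinant were 0, the convention `0⁻¹ = 0` would make `gaussCurvature` vanish,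
    -- against `h^(n+2) > 0`.
    have hT : tangentialDet (‖y‖⁻¹ • y) (supportHessian K (‖y‖⁻¹ • y)) ≠ 0 := by
      intro h0
      rw [gaussCurvature, ← hh, ← hX] at e2
      have h0' : tangentialDet (‖y‖⁻¹ • y) (fderiv ℝ X (‖y‖⁻¹ • y)) = 0 := h0
      rw [h0', inv_zero, mul_zero] at e2
      exact hpow.ne e2
    have e3 : φ (h (‖y‖⁻¹ • y)) ‖X (‖y‖⁻¹ • y)‖ = h (‖y‖⁻¹ • y) ^ (n + 2) *
        tangentialDet (‖y‖⁻¹ • y) (supportHessian K (‖y‖⁻¹ • y)) := by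
      rw [← e2, mul_assoc]
      have : gaussCurvature K (‖y‖⁻¹ • y) *
          tangentialDet (‖y‖⁻¹ • y) (supportHessian K (‖y‖⁻¹ • y)) = 1 := inv_mul_cancel₀ hT
      rw [this, mul_one]
    rw [e1, ← hh, ← e3, hX, hK.gradient_smul hy (by positivity), hh,
      hK.support_smul (by positivity)]
    simp only [hw, inv_mul_eq_div]
    rfl
  have hwpos : ∀ y, y ≠ 0 → 0 < w y := fun y hy =>
    hφ_pos _ _ (div_pos (hhpos y hy) (norm_pos_iff.mpr hy)) (hXpos y hy)
  have hwd : ∀ y, y ≠ 0 → w y = |(dualityHessian K y).det| := fun y hy => by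
    rw [hdet y hy, abs_of_pos (hwpos y hy)]
  have hXs : ContDiffOn ℝ 1 X {0}ᶜ := fun y hy =>
    ((contDiffAt_gradient_supportFunction hK hy).of_le (by simp)).contDiffWithinAt
  have hhs : ContDiffOn ℝ 1 h {0}ᶜ := by
    refine (hXs.inner ℝ contDiffOn_id).congr fun y hy => ?_
    exact (hK.inner_gradient hy).symm
  have hws : ContDiffOn ℝ 1 w {0}ᶜ := by
    have h1 : ContDiffOn ℝ 1 (fun y => (h y / ‖y‖, ‖X y‖)) {0}ᶜ :=
      (hhs.div (contDiffOn_id.norm ℝ fun y hy => hy) fun y hy => norm_ne_zero_iff.mpr hy).prodMk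
        (hXs.norm ℝ fun y hy => hK.gradient_ne_zero hy)
    exact hφ_smooth.comp h1 fun y hy =>
      ⟨div_pos (hhpos y hy) (norm_pos_iff.mpr hy), hXpos y hy⟩
  -- The coefficients are the derivatives of `h/|y|` and `|X|` in the direction `T = h X`. They come
  -- from `dh(T) = h|X|²`, `d|y|(T) = h²/|y|` and `dX(T) = h D²h X`.
  have hderiv : ∀ y, y ≠ 0 → fderiv ℝ w y (dualityMap K y)
      = h y * (‖X y‖ ^ 2 * ‖y‖ ^ 2 - h y ^ 2) / ‖y‖ ^ 3 *
          deriv (fun s => φ s ‖X y‖) (h y / ‖y‖)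
        + h y * inner ℝ (supportHessian K y (X y)) (X y) / ‖X y‖ *
          deriv (fun t => φ (h y / ‖y‖) t) ‖X y‖ := by
    intro y hy
    have hy' : ‖y‖ ≠ 0 := norm_ne_zero_iff.mpr hy
    have hline : HasDerivAt (fun t : ℝ => y + t • dualityMap K y) (dualityMap K y) 0 := by
      simpa using ((hasDerivAt_id (0 : ℝ)).smul_const (dualityMap K y)).const_add y
    have h0 : y + (0 : ℝ) • dualityMap K y = y := by simp
    have d1 := ((h0.symm ▸ hK.hasFDerivAt_supportFunction hy : HasFDerivAt h _
      (y + (0 : ℝ) • dualityMap K y))).comp_hasDerivAt 0 hline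
    have d2 := hasDerivAt_norm_of_ne_zero hline (by rwa [h0])
    have d3 := ((h0.symm ▸ hK.hasFDerivAt_gradient hy : HasFDerivAt X _
      (y + (0 : ℝ) • dualityMap K y))).comp_hasDerivAt 0 hline
    have d4 := hasDerivAt_norm_of_ne_zero d3 (by
      rw [Function.comp_apply, h0]
      exact hK.gradient_ne_zero hy)
    have d5 := d1.div d2 (by rwa [h0])
    have hopen : (Set.Ioi (0 : ℝ) ×ˢ Set.Ioi (0 : ℝ)) ∈ nhds (h y / ‖y‖, ‖X y‖) :=
      (isOpen_Ioi.prod isOpen_Ioi).mem_nhds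
        ⟨div_pos (hhpos y hy) (norm_pos_iff.mpr hy), hXpos y hy⟩
    have hφd : DifferentiableAt ℝ (Function.uncurry φ) (h y / ‖y‖, ‖X y‖) :=
      (hφ_smooth.differentiableOn one_ne_zero).differentiableAt hopen
    have d6 := hasDerivAt_uncurry_comp (φ := φ) (by
      simpa only [Pi.div_apply, Function.comp_apply, h0] using hφd) d5 d4
    have d7 := (((hws.differentiableOn one_ne_zero).differentiableAt
      (isOpen_ne.mem_nhds (h0.symm ▸ hy))).hasFDerivAt
        (x := y + (0 : ℝ) • dualityMap K y)).comp_hasDerivAt 0 hline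
    have d8 := d7.unique d6
    simp only [Pi.div_apply, Function.comp_apply, h0] at d8
    rw [d8]
    have hiXX : inner ℝ (X y) (X y) = ‖X y‖ ^ 2 := real_inner_self_eq_norm_sq _
    have hiyX : inner ℝ y (X y) = h y := by
      rw [real_inner_comm]
      exact hK.inner_gradient hy
    have hT : dualityMap K y = h y • X y := rfl
    congr 2
    · rw [hT, innerSL_apply_apply, real_inner_smul_right, real_inner_smul_right, hiyX]
      change (h y * inner ℝ (X y) (X y) * ‖y‖ - _) / _ = _
      rw [hiXX]
      field_simp
    · rw [hT, map_smul, real_inner_smul_right, real_inner_comm]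
  have hCS : ∀ y, y ≠ 0 → 0 ≤ ‖X y‖ ^ 2 * ‖y‖ ^ 2 - h y ^ 2 := by
    intro y hy
    have h1 : h y ≤ ‖X y‖ * ‖y‖ := by
      rw [hh, ← hK.inner_gradient hy]
      exact real_inner_le_norm _ _
    have h2 := pow_le_pow_left₀ (hhpos y hy).le h1 2
    rw [mul_pow] at h2
    linarith
  have hA : ∀ y, y ≠ 0 → 0 ≤ inner ℝ (supportHessian K y (X y)) (X y) := fun y hy =>
    hK.inner_supportHessian_self_nonneg hy _
  have hterm₁ : ∀ y, y ≠ 0 → 0 ≤ h y * (‖X y‖ ^ 2 * ‖y‖ ^ 2 - h y ^ 2) / ‖y‖ ^ 3 := fun y hy =>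
    div_nonneg (mul_nonneg (hhpos y hy).le (hCS y hy)) (by positivity)
  have hterm₂ : ∀ y, y ≠ 0 → 0 ≤ h y * inner ℝ (supportHessian K y (X y)) (X y) / ‖X y‖ :=
    fun y hy => div_nonneg (mul_nonneg (hhpos y hy).le (hA y hy)) (norm_nonneg _)
  have hφ₁ : ∀ y, y ≠ 0 → 0 ≤ deriv (fun s => φ s ‖X y‖) (h y / ‖y‖) := fun y hy =>
    hφ_one _ _ (div_pos (hhpos y hy) (norm_pos_iff.mpr hy)) (hXpos y hy)
  have hφ₂ : ∀ y, y ≠ 0 → 0 ≤ deriv (fun t => φ (h y / ‖y‖) t) ‖X y‖ := fun y hy =>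
    hφ_two _ _ (div_pos (hhpos y hy) (norm_pos_iff.mpr hy)) (hXpos y hy)
  have hG : ∀ y, y ≠ 0 → 0 ≤ fderiv ℝ w y (dualityMap K y) := fun y hy => by
    rw [hderiv y hy]
    exact add_nonneg (mul_nonneg (hterm₁ y hy) (hφ₁ y hy)) (mul_nonneg (hterm₂ y hy) (hφ₂ y hy))
  refine hK.frontier_eq_sphere hn fun y hy => ?_
  have hzero := hK.fderiv_weight_dualityMap_eq_zero hws hwd hcentred hG hy
  rw [hderiv y hy] at hzero
  have hy' : ‖y‖ ≠ 0 := norm_ne_zero_iff.mpr hy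
  obtain ⟨z1, z2⟩ := (add_eq_zero_iff_of_nonneg (mul_nonneg (hterm₁ y hy) (hφ₁ y hy))
    (mul_nonneg (hterm₂ y hy) (hφ₂ y hy))).mp hzero
  -- Both summands of `dw(T)` vanish. The strictly positive partial derivative, which may depend on
  -- `y`, selects which geometric coefficient is 0.
  rcases hφ_strict _ _ (div_pos (hhpos y hy) (norm_pos_iff.mpr hy)) (hXpos y hy) with hs | hs
  · refine hK.eq_smul_of_norm_mul_norm_eq hy ?_
    have h1 := (mul_eq_zero.mp z1).resolve_right hs.ne'
    rw [div_eq_zero_iff] at h1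
    have h2 := (mul_eq_zero.mp (h1.resolve_right (by positivity))).resolve_left (hhpos y hy).ne'
    exact sub_eq_zero.mp h2
  · refine hK.eq_smul_of_inner_supportHessian_eq_zero hy (hdet y hy ▸ (hwpos y hy).ne') ?_
    have h1 := (mul_eq_zero.mp z2).resolve_right hs.ne'
    rw [div_eq_zero_iff] at h1
    exact (mul_eq_zero.mp (h1.resolve_right (hXpos y hy).ne')).resolve_left (hhpos y hy).ne'
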